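/- Let $\gamma>2$ be real. A body $C_\gamma$ is any compact convex set $C_\gamma\subset(-1/2,1/2)^2\subset\mathbb{R}^2$ for which there is an open neighbourhood $U$ of the origin, with $\frac12U\subseteq U$, such that $\partial C_\gamma\cap U=\{(x,|x|^\gamma):x\in\mathbb{R}\}\cap U$ and such that, outside $\frac12U$, $\partial C_\gamma$ is smooth ($C^\infty$) with curvature bounded below by some constant $\kappa>0$. For a compact convex set $C\subset\mathbb{R}^2$, $R>0$ and $t\in\mathbb{R}^2$ let $$\mathcal{D}(RC+t)=-R^2|C|+\mathrm{card}\big((RC+t)\cap\mathbb{Z}^2\big),$$ where $|C|$ is the area of $C$. Identify the torus $\mathbb{T}^2=\mathbb{R}^2/\mathbb{Z}^2$ with $[-1/2,1/2)^2$, with Lebesgue measure $dt$, and let $d\sigma$ be the normalized Haar measure on $SO(2)$. Then for every $\gamma>2$, every body $C_\gamma$ and every real $p\ge1$ there is a constant $c>0$ such that, for all real $R\ge1$, $$\left\{\int_{SO(2)}\int_{\mathbb{T}^2}\left|\mathcal{D}\big(R\,\sigma(C_\gamma)+t\big)\right|^p\,dt\,d\sigma\right\}^{1/p}\ \ge\ c\,R^{1/2}.$$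 -/

import Mathlib

open scoped Pointwise ContDiff Topology

noncomputable section

/-- The Euclidean plane `ℝ²`. -/
abbrev Plane : Type := EuclideanSpace ℝ (Fin 2)

/-- The set `S` is, near its point `P`, a smooth (`C^∞`) curve whose curvature at `P` is at least `κ`.
In suitable Cartesian coordinates with origin at `P` and first axis tangent to the curve, `S`
coincides near `P` with the graph of a smooth function `f`, where `f(0) = f'(0) = 0`; in such
coordinates the curvature at `P` is `|f''(0)|`. -/
def SmoothWithCurvatureGE (S : Set Plane) (κ : ℝ) (P : Plane) : Prop :=
  ∃ (e : Plane ≃ₗᵢ[ℝ] Plane) (f : ℝ → ℝ),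
    ContDiff ℝ ∞ f ∧ f 0 = 0 ∧ deriv f 0 = 0 ∧ κ ≤ |deriv (deriv f) 0| ∧
    ∀ᶠ v in 𝓝 (0 : Plane), (P + e v ∈ S ↔ v 1 = f (v 0))

/-- `C` is one of the bodies `C_γ`: a compact convex subset of the open square `(-1/2, 1/2)²`
whose boundary coincides, in a neighbourhood `U` of the origin, with the graph of `x ↦ |x|^γ`,
and is smooth with curvature bounded below by a positive constant outside `(1/2) U`. -/
structure IsFlatBody (γ : ℝ) (C : Set Plane) : Prop where
  isCompact : IsCompact C
  convex : Convex ℝ C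
  subset_square : ∀ x ∈ C, ∀ i, -(1 / 2 : ℝ) < x i ∧ x i < 1 / 2
  boundary : ∃ U : Set Plane, IsOpen U ∧ (0 : Plane) ∈ U ∧ (1 / 2 : ℝ) • U ⊆ U ∧
    frontier C ∩ U = {x : Plane | x 1 = |x 0| ^ γ} ∩ U ∧
    ∃ κ : ℝ, 0 < κ ∧ ∀ P ∈ frontier C \ (1 / 2 : ℝ) • U, SmoothWithCurvatureGE (frontier C) κ P

/-- The integer points `ℤ²` of the plane. -/
def integerPoints : Set Plane := {x | ∀ i, ∃ n : ℤ, x i = n}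

/-- The discrepancy `𝒟(R C + t) = -R² |C| + card((R C + t) ∩ ℤ²)`. -/
def discrepancy (C : Set Plane) (R : ℝ) (t : Plane) : ℝ :=
  -R ^ 2 * MeasureTheory.volume.real C +
    ((((fun x : Plane => R • x + t) '' C) ∩ integerPoints).ncard : ℝ)

/-- The rotation of the plane about the origin by the angle `θ`, an element of `SO(2)`. -/
def rot (θ : ℝ) (x : Plane) : Plane :=
  !₂[Real.cos θ * x 0 - Real.sin θ * x 1, Real.sin θ * x 0 + Real.cos θ * x 1]

/-- The unit square `[-1/2, 1/2)²`, identified with the torus `𝕋² = ℝ²/ℤ²`. -/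
def torusSquare : Set Plane := {t | ∀ i, -(1 / 2 : ℝ) ≤ t i ∧ t i < 1 / 2}

/-- The average over `σ ∈ SO(2)`, with respect to the normalized Haar measure `dθ / 2π`, and over
`t ∈ 𝕋²` of `|𝒟(R σ(C) + t)|^p`, raised to the power `1/p`. -/
def discrepancyLpAverage (C : Set Plane) (p R : ℝ) : ℝ :=
  ((2 * Real.pi)⁻¹ * ∫ θ in (0 : ℝ)..(2 * Real.pi),
    ∫ t in torusSquare, |discrepancy (rot θ '' C) R t| ^ p) ^ (1 / p)

end

open MeasureTheory Set

/-! For fixed rotation, the `L^p` norm in `t` dominates the `L^1` norm, which dominates any nonzero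
Fourier coefficient of the discrepancy. At a fixed frequency `(K, 0)` this coefficient is `R ^ 2`
times a cosine integral over `C`, that is, a one-dimensional cosine integral of the chord lengths of
`C` in the direction selected by the rotation. It suffices to find an interval of rotations on which
this integral has size at least a constant times `R ^ (-3/2)`.

In general the contributions of the two support points may cancel. Here the flat point prevents
this: since `γ > 2`, the curvature of `|x| ^ γ` tends to `0` at the origin, so for small positive
slopes the chords near the lower support point grow like `c * √s` with `c` as large as desired,
while near the top the curvature is at least `κ` and the chords are at most `B * √s` with `B` fixed
(`exists_bottom_chord_bounds`, `IsFlatBody.exists_top_chord_bound`). With `c` large compared with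
`B` the lower end wins, whatever the phases.

No asymptotic expansion is needed. The chord length is concave, so with the phase anchored at the
lower end each full period contributes a nonpositive amount; the first contributes at most a
negative multiple of `c * h ^ (3/2)`, and the incomplete last one at most `4 * B * h ^ (3/2)` in
absolute value (`ConcaveOn.integral_cos_le`). Here `h` is half the wavelength, comparable to `1 /
R`. -/

/-! ### Cosine integrals of concave functions -/

/-- Both inner points are convex combinations of the outer two, with the weights `t` and `1 - t`
interchanged; adding the two concavity inequalities gives the claim. -/
theorem ConcaveOn.symmetric_pair_le {s : Set ℝ} {f : ℝ → ℝ} (hf : ConcaveOn ℝ s f) {c u v : ℝ}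
    (h1 : c - v ∈ s) (h2 : c + v ∈ s) (hu : |u| ≤ v) :
    f (c - v) + f (c + v) ≤ f (c - u) + f (c + u) := by
  obtain ⟨hu1, hu2⟩ := abs_le.1 hu
  rcases (abs_nonneg u |>.trans hu).eq_or_lt with hv | hv
  · obtain rfl : u = 0 := by linarith
    subst hv; simp
  set t := (v + u) / (2 * v) with ht
  have ht0 : 0 ≤ t := by apply div_nonneg <;> linarith
  have ht1 : 0 ≤ 1 - t := by
    have : 1 - t = (v - u) / (2 * v) := by rw [ht]; field_simp; ring
    rw [this]; apply div_nonneg <;> linarith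
  have htv : t * (2 * v) = v + u := by rw [ht]; field_simp
  have e1 := hf.2 h2 h1 ht0 ht1 (by ring)
  have e2 := hf.2 h2 h1 ht1 ht0 (by ring)
  simp only [smul_eq_mul] at e1 e2
  have g1 : t * (c + v) + (1 - t) * (c - v) = c + u := by linarith
  have g2 : (1 - t) * (c + v) + t * (c - v) = c - u := by linarith
  rw [g1] at e1; rw [g2] at e2
  linarith

/-- The symmetrised second difference of `a` on the period `[b, b + 2h]`. -/
def periodDefect (a : ℝ → ℝ) (b h s : ℝ) : ℝ :=
  a (b + h - s) + a (b + h + s) - (a (b + s) + a (b + 2 * h - s))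

theorem periodDefect_nonneg {a : ℝ → ℝ} {b h s : ℝ} (ha : ConcaveOn ℝ (Icc b (b + 2 * h)) a)
    (hs : s ∈ Icc 0 (h / 2)) : 0 ≤ periodDefect a b h s := by
  obtain ⟨h0, h1⟩ := hs
  have := ha.symmetric_pair_le (c := b + h) (u := s) (v := h - s)
    ⟨by linarith, by linarith⟩ ⟨by linarith, by linarith⟩ (abs_le.2 ⟨by linarith, by linarith⟩)
  unfold periodDefect
  rw [show b + h - (h - s) = b + s by ring, show b + h + (h - s) = b + 2 * h - s by ring] at this
  linarith

/-- Reflections and translations fold the four quarter periods onto `[0, h / 2]`, where the cosine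
appears with signs `+, -, -, +`; the signed sum of the values of `a` is minus the defect. -/
theorem integral_period_cos {a : ℝ → ℝ} {b h : ℝ} (hh : 0 < h)
    (ha : IntervalIntegrable a volume b (b + 2 * h)) :
    IntervalIntegrable (fun s => periodDefect a b h s * Real.cos (Real.pi / h * s)) volume 0 (h / 2) ∧
    ∫ s in b..(b + 2 * h), a s * Real.cos (Real.pi / h * (s - b)) =
      -∫ s in (0 : ℝ)..(h / 2), periodDefect a b h s * Real.cos (Real.pi / h * s) := by
  set F : ℝ → ℝ := fun s => a s * Real.cos (Real.pi / h * (s - b)) with hF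
  have hFi : IntervalIntegrable F volume b (b + 2 * h) := by
    apply ha.mul_continuousOn; fun_prop
  have sub : ∀ u v, u ∈ Icc b (b + 2 * h) → v ∈ Icc b (b + 2 * h) →
      IntervalIntegrable F volume u v := fun u v hu hv => hFi.mono_set (by
    rw [uIcc_of_le (a := b) (b := b + 2 * h) (by linarith)]
    exact uIcc_subset_Icc hu hv)
  have i1 := sub b (b + h / 2) ⟨by linarith, by linarith⟩ ⟨by linarith, by linarith⟩
  have i2 := sub (b + h / 2) (b + h) ⟨by linarith, by linarith⟩ ⟨by linarith, by linarith⟩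
  have i3 := sub (b + h) (b + h + h / 2) ⟨by linarith, by linarith⟩ ⟨by linarith, by linarith⟩
  have i4 := sub (b + h + h / 2) (b + 2 * h) ⟨by linarith, by linarith⟩ ⟨by linarith, by linarith⟩
  have hpi : Real.pi / h * h = Real.pi := by field_simp
  have c1 : ∀ s, F (b + s) = a (b + s) * Real.cos (Real.pi / h * s) := fun s => by
    simp only [hF]; congr 2; ring
  have c2 : ∀ s, F (b + h - s) = -(a (b + h - s) * Real.cos (Real.pi / h * s)) := fun s => by
    simp only [hF]
    rw [show Real.pi / h * (b + h - s - b) = Real.pi - Real.pi / h * s by linear_combination hpi,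
      Real.cos_pi_sub]; ring
  have c3 : ∀ s, F (b + h + s) = -(a (b + h + s) * Real.cos (Real.pi / h * s)) := fun s => by
    simp only [hF]
    rw [show Real.pi / h * (b + h + s - b) = Real.pi / h * s + Real.pi by linear_combination hpi,
      Real.cos_add_pi]; ring
  have c4 : ∀ s, F (b + 2 * h - s) = a (b + 2 * h - s) * Real.cos (Real.pi / h * s) := fun s => by
    simp only [hF]
    rw [show Real.pi / h * (b + 2 * h - s - b) = 2 * Real.pi - Real.pi / h * s by
      linear_combination 2 * hpi, Real.cos_two_pi_sub]
  have j1 : IntervalIntegrable (fun s => F (b + s)) volume 0 (h / 2) := by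
    simpa using i1.comp_add_left b
  have j2 : IntervalIntegrable (fun s => F (b + h - s)) volume 0 (h / 2) := by
    have := (i2.comp_sub_left (b + h)).symm
    convert this using 1 <;> ring
  have j3 : IntervalIntegrable (fun s => F (b + h + s)) volume 0 (h / 2) := by
    simpa using i3.comp_add_left (b + h)
  have j4 : IntervalIntegrable (fun s => F (b + 2 * h - s)) volume 0 (h / 2) := by
    have := (i4.comp_sub_left (b + 2 * h)).symm
    convert this using 1 <;> ring
  have e1 : ∫ s in (0 : ℝ)..(h / 2), F (b + s) = ∫ s in b..(b + h / 2), F s := by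
    rw [intervalIntegral.integral_comp_add_left]; simp
  have e2 : ∫ s in (0 : ℝ)..(h / 2), F (b + h - s) = ∫ s in (b + h / 2)..(b + h), F s := by
    rw [intervalIntegral.integral_comp_sub_left]; congr 1 <;> ring
  have e3 : ∫ s in (0 : ℝ)..(h / 2), F (b + h + s) = ∫ s in (b + h)..(b + h + h / 2), F s := by
    rw [intervalIntegral.integral_comp_add_left]; simp
  have e4 : ∫ s in (0 : ℝ)..(h / 2), F (b + 2 * h - s)
      = ∫ s in (b + h + h / 2)..(b + 2 * h), F s := by
    rw [intervalIntegral.integral_comp_sub_left]; congr 1 <;> ring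
  have key : ∀ s, periodDefect a b h s * Real.cos (Real.pi / h * s) =
      -(F (b + s) + F (b + h - s) + F (b + h + s) + F (b + 2 * h - s)) := fun s => by
    rw [c1, c2, c3, c4]; unfold periodDefect; ring
  constructor
  · simp_rw [key]
    exact (((j1.add j2).add j3).add j4).neg
  · simp_rw [key]
    rw [intervalIntegral.integral_neg, neg_neg,
      intervalIntegral.integral_add ((j1.add j2).add j3) j4,
      intervalIntegral.integral_add (j1.add j2) j3, intervalIntegral.integral_add j1 j2,
      e1, e2, e3, e4, intervalIntegral.integral_add_adjacent_intervals i1 i2,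
      intervalIntegral.integral_add_adjacent_intervals (i1.trans i2) i3,
      intervalIntegral.integral_add_adjacent_intervals ((i1.trans i2).trans i3) i4]

theorem cos_nonneg_of_mem_quarter {h s : ℝ} (hh : 0 < h) (hs : s ∈ Icc 0 (h / 2)) :
    0 ≤ Real.cos (Real.pi / h * s) := by
  apply Real.cos_nonneg_of_mem_Icc
  have hpi := Real.pi_pos
  have h2 : Real.pi / h * s ≤ Real.pi / h * (h / 2) := by
    apply mul_le_mul_of_nonneg_left hs.2; positivity
  have h3 : Real.pi / h * (h / 2) = Real.pi / 2 := by field_simp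
  have h4 : 0 ≤ Real.pi / h * s := mul_nonneg (by positivity) hs.1
  exact ⟨by linarith, by linarith⟩

theorem ConcaveOn.integral_period_cos_nonpos {a : ℝ → ℝ} {b h : ℝ} (hh : 0 < h)
    (ha : ConcaveOn ℝ (Icc b (b + 2 * h)) a)
    (hai : IntervalIntegrable a volume b (b + 2 * h)) :
    ∫ s in b..(b + 2 * h), a s * Real.cos (Real.pi / h * (s - b)) ≤ 0 := by
  rw [(integral_period_cos hh hai).2, neg_nonpos]
  apply intervalIntegral.integral_nonneg (by linarith)
  intro s hs
  exact mul_nonneg (periodDefect_nonneg ha hs) (cos_nonneg_of_mem_quarter hh hs)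

/-- The first period of a concave function that behaves like a square root. -/
theorem ConcaveOn.integral_first_period_cos_le {a : ℝ → ℝ} {h c : ℝ} (hh : 0 < h) (hc : 0 < c)
    (ha : ConcaveOn ℝ (Icc 0 (2 * h)) a) (hai : IntervalIntegrable a volume 0 (2 * h))
    (hlow : ∀ s ∈ Icc 0 (2 * h), c * √s ≤ a s)
    (hupp : ∀ s ∈ Icc 0 (2 * h), a s ≤ 1.11 * c * √s) :
    ∫ s in (0 : ℝ)..(2 * h), a s * Real.cos (Real.pi / h * s) ≤ -(c * √h * h / 400) := by
  have ha' : ConcaveOn ℝ (Icc 0 (0 + 2 * h)) a := by simpa using ha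
  obtain ⟨hi, he⟩ := integral_period_cos (a := a) (b := 0) hh (by simpa using hai)
  simp only [zero_add, sub_zero] at he
  rw [he, neg_le_neg_iff]
  have hs1 : ∀ r : ℝ, 0 ≤ r → √(r * h) = √r * √h := fun r hr => Real.sqrt_mul hr h
  have hsq : 0 < √h := Real.sqrt_pos.2 hh
  -- The gain is taken only from `[0, h / 32]`; on the rest of the quarter period the integrand is
  -- nonnegative.
  have hi' : IntervalIntegrable (fun s => periodDefect a 0 h s * Real.cos (Real.pi / h * s))
      volume 0 (h / 32) := hi.mono_set (by
    rw [uIcc_of_le (by linarith), uIcc_of_le (by linarith)]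
    exact Icc_subset_Icc le_rfl (by linarith))
  have hnn : ∀ s ∈ Icc 0 (h / 2), 0 ≤ periodDefect a 0 h s * Real.cos (Real.pi / h * s) :=
    fun s hs => mul_nonneg (periodDefect_nonneg ha' hs) (cos_nonneg_of_mem_quarter hh hs)
  have hi'' : IntervalIntegrable (fun s => periodDefect a 0 h s * Real.cos (Real.pi / h * s))
      volume (h / 32) (h / 2) := hi.mono_set (by
    rw [uIcc_of_le (by linarith), uIcc_of_le (by linarith)]
    exact Icc_subset_Icc (by linarith) le_rfl)
  rw [← intervalIntegral.integral_add_adjacent_intervals hi' hi'']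
  have t2 : 0 ≤ ∫ s in (h / 32)..(h / 2),
      periodDefect a 0 h s * Real.cos (Real.pi / h * s) := by
    apply intervalIntegral.integral_nonneg (by linarith)
    intro s hs; exact hnn s ⟨by linarith [hs.1], hs.2⟩
  have t1 : ∫ s in (0 : ℝ)..(h / 32), (c * √h * 32 / 400) ≤
      ∫ s in (0 : ℝ)..(h / 32), periodDefect a 0 h s * Real.cos (Real.pi / h * s) := by
    apply intervalIntegral.integral_mono_on (by linarith) (by simp) hi'
    rintro s ⟨h0, h1⟩
    have hcos : (9 / 10 : ℝ) ≤ Real.cos (Real.pi / h * s) := by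
      have hx0 : 0 ≤ Real.pi / h * s := mul_nonneg (by positivity) h0
      have hx : Real.pi / h * s ≤ Real.pi / h * (h / 32) := by
        apply mul_le_mul_of_nonneg_left h1; positivity
      have h3 : Real.pi / h * (h / 32) = Real.pi / 32 := by field_simp
      have := Real.one_sub_sq_div_two_le_cos (x := Real.pi / h * s)
      have hpi := Real.pi_le_four
      have : (Real.pi / h * s) ^ 2 ≤ (1 / 8) ^ 2 := by
        apply pow_le_pow_left₀ hx0; linarith
      linarith
    have l1 : c * √((31 / 32) * h) ≤ a (0 + h - s) :=
      (mul_le_mul_of_nonneg_left (Real.sqrt_le_sqrt (by linarith)) hc.le).trans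
        (hlow _ ⟨by linarith, by linarith⟩)
    have l2 : c * √h ≤ a (0 + h + s) :=
      (mul_le_mul_of_nonneg_left (Real.sqrt_le_sqrt (by linarith)) hc.le).trans
        (hlow _ ⟨by linarith, by linarith⟩)
    have u1 : a (0 + s) ≤ 1.11 * c * √((1 / 32) * h) :=
      (hupp _ ⟨by linarith, by linarith⟩).trans
        (mul_le_mul_of_nonneg_left (Real.sqrt_le_sqrt (by linarith)) (by positivity))
    have u2 : a (0 + 2 * h - s) ≤ 1.11 * c * √(2 * h) :=
      (hupp _ ⟨by linarith, by linarith⟩).trans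
        (mul_le_mul_of_nonneg_left (Real.sqrt_le_sqrt (by linarith)) (by positivity))
    rw [hs1 _ (by norm_num)] at l1 u1 u2
    have q1 : (0.98 : ℝ) ≤ √(31 / 32) := Real.le_sqrt_of_sq_le (by norm_num)
    have q2 : √(1 / 32 : ℝ) ≤ 0.18 := by rw [Real.sqrt_le_left (by norm_num)]; norm_num
    have q3 : √(2 : ℝ) ≤ 1.42 := by rw [Real.sqrt_le_left (by norm_num)]; norm_num
    have hch : 0 < c * √h := by positivity
    have m1 : 0.98 * (c * √h) ≤ √(31 / 32) * (c * √h) := mul_le_mul_of_nonneg_right q1 hch.le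
    have m2 : √(1 / 32 : ℝ) * (c * √h) ≤ 0.18 * (c * √h) := mul_le_mul_of_nonneg_right q2 hch.le
    have m3 : √(2 : ℝ) * (c * √h) ≤ 1.42 * (c * √h) := mul_le_mul_of_nonneg_right q3 hch.le
    -- Near `s = 0` the gain is `1 + 1 - √2` for an exact square root. With the tolerance `1.11`
    -- there remains `0.98 + 1 - 1.11 * (0.18 + 1.42) = 0.204`.
    have d : 0.2 * (c * √h) ≤ periodDefect a 0 h s := by
      unfold periodDefect
      norm_num at *
      linarith
    have : 0.2 * (c * √h) * (9 / 10) ≤ periodDefect a 0 h s * Real.cos (Real.pi / h * s) :=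
      mul_le_mul d hcos (by norm_num) (le_trans (by positivity) d)
    norm_num at *
    linarith
  rw [intervalIntegral.integral_const, smul_eq_mul] at t1
  linarith

/-- The first full period gives the term with `c`, the other full periods have the right sign by
concavity, and the remainder at the far end gives the term with `C`. -/
theorem ConcaveOn.integral_cos_le {a : ℝ → ℝ} {L δ h c C : ℝ} (hh : 0 < h) (hc : 0 < c)
    (hδ : 2 * h ≤ δ) (hδL : δ ≤ L) (hC : 0 ≤ C)
    (ha : ConcaveOn ℝ (Icc 0 L) a) (hai : IntervalIntegrable a volume 0 L)
    (hlow : ∀ s ∈ Icc 0 δ, c * √s ≤ a s)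
    (hupp : ∀ s ∈ Icc 0 δ, a s ≤ 1.11 * c * √s)
    (htop : ∀ s ∈ Icc 0 δ, |a (L - s)| ≤ C * √s) :
    ∫ s in (0 : ℝ)..L, a s * Real.cos (Real.pi / h * s) ≤ (4 * C - c / 400) * (√h * h) := by
  set F : ℝ → ℝ := fun s => a s * Real.cos (Real.pi / h * s) with hF
  set N := ⌊L / (2 * h)⌋₊ with hN
  have hL : 0 < L := by linarith
  have hN1 : (N : ℝ) * (2 * h) ≤ L := by
    have := Nat.floor_le (a := L / (2 * h)) (by positivity)
    rwa [le_div_iff₀ (by positivity)] at this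
  have hN2 : L - N * (2 * h) ≤ 2 * h := by
    have := (Nat.lt_floor_add_one (L / (2 * h)))
    rw [div_lt_iff₀ (by positivity)] at this
    linarith
  have hN0 : 1 ≤ N := by
    rw [hN, Nat.one_le_floor_iff, one_le_div (by positivity)]; linarith
  have hFi : IntervalIntegrable F volume 0 L := by
    apply hai.mul_continuousOn; fun_prop
  have suba : ∀ u v, u ∈ Icc 0 L → v ∈ Icc 0 L → uIcc u v ⊆ uIcc 0 L := fun u v hu hv => by
    rw [uIcc_of_le hL.le]; exact uIcc_subset_Icc hu hv
  have hk : ∀ k : ℕ, k ≤ N → (k : ℝ) * (2 * h) ∈ Icc 0 L := fun k hk =>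
    ⟨by positivity, le_trans (mul_le_mul_of_nonneg_right (by exact_mod_cast hk) (by positivity)) hN1⟩
  have hsum : ∀ n : ℕ, 1 ≤ n → n ≤ N →
      ∫ s in (0 : ℝ)..(n * (2 * h)), F s ≤ -(c * √h * h / 400) := by
    intro n hn
    induction n, hn using Nat.le_induction with
    | base =>
      intro _
      have h2 : (2 * h) ≤ L := by linarith
      have := ConcaveOn.integral_first_period_cos_le hh hc
        (ha.subset (Icc_subset_Icc le_rfl h2) (convex_Icc _ _))
        (hai.mono_set (suba 0 (2 * h) ⟨le_rfl, hL.le⟩ ⟨by linarith, h2⟩))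
        (fun s hs => hlow s ⟨hs.1, hs.2.trans hδ⟩) (fun s hs => hupp s ⟨hs.1, hs.2.trans hδ⟩)
      simpa using this
    | succ k hk1 ih =>
      intro hkN
      have m0 : (0 : ℝ) ∈ Icc 0 L := ⟨le_rfl, hL.le⟩
      have m1 := hk k (by omega)
      have m2 := hk (k + 1) hkN
      have hb : ((k + 1 : ℕ) : ℝ) * (2 * h) = k * (2 * h) + 2 * h := by push_cast; ring
      rw [← intervalIntegral.integral_add_adjacent_intervals
        (hFi.mono_set (suba 0 _ m0 m1)) (hFi.mono_set (suba _ _ m1 m2))]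
      have := ConcaveOn.integral_period_cos_nonpos (a := a) (b := k * (2 * h)) hh
        (ha.subset (Icc_subset_Icc m1.1 (hb ▸ m2.2)) (convex_Icc _ _))
        (hai.mono_set (suba _ _ m1 (hb ▸ m2)))
      have e : ∀ s, Real.cos (Real.pi / h * (s - k * (2 * h))) = Real.cos (Real.pi / h * s) := by
        intro s
        rw [show Real.pi / h * (s - k * (2 * h)) = Real.pi / h * s - k * (2 * Real.pi) by
          field_simp, Real.cos_sub_nat_mul_two_pi]
      simp_rw [e] at this
      rw [hb]
      linarith [ih (by omega)]
  have m1 := hk N le_rfl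
  have mL : L ∈ Icc 0 L := ⟨hL.le, le_rfl⟩
  rw [← intervalIntegral.integral_add_adjacent_intervals
    (hFi.mono_set (suba 0 _ ⟨le_rfl, hL.le⟩ m1)) (hFi.mono_set (suba _ _ m1 mL))]
  -- The incomplete period lies within `2 * h` of `L`, where `htop` bounds `a` by `C * √(2 * h)`, at
  -- most `2 * C * √h`.
  have hrem : ‖∫ s in (N * (2 * h))..L, F s‖ ≤ (C * √(2 * h)) * |L - N * (2 * h)| := by
    apply intervalIntegral.norm_integral_le_of_norm_le_const
    intro s hs
    rw [uIoc_of_le hN1] at hs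
    have := htop (L - s) ⟨by linarith [hs.2], by linarith [hs.1]⟩
    rw [sub_sub_cancel] at this
    rw [hF, norm_mul, Real.norm_eq_abs, Real.norm_eq_abs]
    calc |a s| * |Real.cos (Real.pi / h * s)| ≤ (C * √(L - s)) * 1 :=
          mul_le_mul this (Real.abs_cos_le_one _) (abs_nonneg _) (by positivity)
      _ ≤ C * √(2 * h) := by
          rw [mul_one]
          exact mul_le_mul_of_nonneg_left (Real.sqrt_le_sqrt (by linarith [hs.1])) hC
  have hrem2 : (C * √(2 * h)) * |L - N * (2 * h)| ≤ (C * (2 * √h)) * (2 * h) := by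
    apply mul_le_mul _ _ (abs_nonneg _) (by positivity)
    · apply mul_le_mul_of_nonneg_left _ hC
      rw [Real.sqrt_mul (by norm_num)]
      apply mul_le_mul_of_nonneg_right _ (Real.sqrt_nonneg _)
      rw [Real.sqrt_le_left (by norm_num)]; norm_num
    · rw [abs_of_nonneg (by linarith)]; exact hN2
  have := (le_abs_self _).trans (hrem.trans hrem2)
  have := hsum N hN0 le_rfl
  linarith

/-! ### Chords of a convex body in a given direction -/

/-- The point of the plane with coordinates `x` and `y`. -/
def planePoint (x y : ℝ) : Plane := !₂[x, y]

@[simp] theorem planePoint_zero (x y : ℝ) : planePoint x y 0 = x := rfl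
@[simp] theorem planePoint_one (x y : ℝ) : planePoint x y 1 = y := rfl

theorem planePoint_eta (v : Plane) : planePoint (v 0) (v 1) = v := by
  ext i; fin_cases i <;> rfl

theorem plane_ext {v w : Plane} (h0 : v 0 = w 0) (h1 : v 1 = w 1) : v = w := by
  ext i; fin_cases i <;> assumption

theorem combo_planePoint (a b x y x' y' : ℝ) :
    a • planePoint x y + b • planePoint x' y' = planePoint (a * x + b * x') (a * y + b * y') := by
  apply plane_ext <;> simp

@[fun_prop]
theorem Continuous.planePoint {X : Type*} [TopologicalSpace X] {f g : X → ℝ} (hf : Continuous f)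
    (hg : Continuous g) : Continuous fun x => planePoint (f x) (g x) := by
  unfold _root_.planePoint
  apply (PiLp.continuous_toLp 2 _).comp
  refine continuous_pi fun i => ?_
  fin_cases i <;> simpa

theorem measurePreserving_planePoint :
    MeasurePreserving (fun p : ℝ × ℝ => planePoint p.1 p.2) := by
  exact (PiLp.volume_preserving_toLp (Fin 2)).comp (volume_preserving_finTwoArrow ℝ).symm

theorem measurePreserving_shear (m : ℝ) :
    MeasurePreserving (fun p : ℝ × ℝ => planePoint p.1 (p.2 + m * p.1)) := by
  have h : MeasurePreserving (fun p : ℝ × ℝ => (p.1, p.2 + m * p.1)) :=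
    (MeasurePreserving.id (volume : Measure ℝ)).skew_product (g := fun x y => y + m * x)
      (by fun_prop) (.of_forall fun x => (measurePreserving_add_right volume (m * x)).map_eq)
  exact measurePreserving_planePoint.comp h

/-- The slice of `C` by the line `x₁ = y + m x₀`, parametrised by its first coordinate. -/
def slice (C : Set Plane) (m y : ℝ) : Set ℝ := {x | planePoint x (y + m * x) ∈ C}

/-- The horizontal extent of the chord which `C` cuts out of the line `x₁ = y + m x₀`. -/
noncomputable def chord (C : Set Plane) (m y : ℝ) : ℝ := volume.real (slice C m y)

theorem chord_nonneg (C : Set Plane) (m y : ℝ) : 0 ≤ chord C m y := measureReal_nonneg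

theorem integrable_shear {C : Set Plane} (hC : IsCompact C) (m : ℝ) {g : ℝ → ℝ}
    (hg : Continuous g) :
    Integrable (fun p : ℝ × ℝ => (slice C m p.2).indicator (fun _ => g p.2) p.1) := by
  have h1 : IntegrableOn (fun v : Plane => g (v 1 - m * v 0)) C :=
    (ContinuousOn.integrableOn_compact hC (by fun_prop))
  have h2 := (measurePreserving_shear m).integrable_comp_of_integrable
    (h1.integrable_indicator hC.isClosed.measurableSet)
  refine h2.congr (.of_forall fun p => ?_)
  by_cases hp : planePoint p.1 (p.2 + m * p.1) ∈ C
  · have : p.1 ∈ slice C m p.2 := hp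
    simp [hp, this]
  · have : p.1 ∉ slice C m p.2 := hp
    simp [hp, this]

theorem isClosed_slice {C : Set Plane} (hC : IsClosed C) (m y : ℝ) :
    IsClosed (slice C m y) := by
  apply hC.preimage; fun_prop

theorem integral_slice {C : Set Plane} (hC : IsCompact C) (m : ℝ) (g : ℝ → ℝ) (y : ℝ) :
    ∫ x, (slice C m y).indicator (fun _ => g y) x = chord C m y * g y := by
  rw [integral_indicator (isClosed_slice hC.isClosed m y).measurableSet, setIntegral_const,
    smul_eq_mul, chord]

theorem integrable_chord_mul {C : Set Plane} (hC : IsCompact C) (m : ℝ) {g : ℝ → ℝ}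
    (hg : Continuous g) : Integrable (fun y => chord C m y * g y) := by
  have := (integrable_shear hC m hg).integral_prod_right
  simpa only [integral_slice hC] using this

theorem integrable_chord {C : Set Plane} (hC : IsCompact C) (m : ℝ) :
    Integrable (chord C m) := by
  simpa using integrable_chord_mul hC m (g := fun _ => 1) continuous_const

/-- Fubini in sheared coordinates; the shear preserves area, so no factor depending on `m` appears.
-/
theorem setIntegral_linear_eq_integral_chord {C : Set Plane} (hC : IsCompact C) (m : ℝ) {g : ℝ → ℝ}
    (hg : Continuous g) :
    ∫ v in C, g (v 1 - m * v 0) = ∫ y, chord C m y * g y := by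
  simp_rw [← integral_slice hC]
  rw [← integral_prod_symm _ (integrable_shear hC m hg),
    ← integral_indicator hC.isClosed.measurableSet, ← (measurePreserving_shear m).map_eq,
    integral_map (measurePreserving_shear m).aemeasurable]
  · refine integral_congr_ae (.of_forall fun p => ?_)
    by_cases hp : planePoint p.1 (p.2 + m * p.1) ∈ C
    · have : p.1 ∈ slice C m p.2 := hp
      simp [hp, this]
    · have : p.1 ∉ slice C m p.2 := hp
      simp [hp, this]
  · apply Measurable.aestronglyMeasurable
    apply Measurable.indicator _ hC.isClosed.measurableSet
    exact (by fun_prop : Continuous fun v : Plane => g (v 1 - m * v 0)).measurable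

theorem mem_slice_self {C : Set Plane} (m : ℝ) {v : Plane} (hv : v ∈ C) :
    v 0 ∈ slice C m (v 1 - m * v 0) := by
  simpa [slice, planePoint_eta] using hv

theorem combo_mem_slice {C : Set Plane} (hC : Convex ℝ C) {m y y' x x' a b : ℝ}
    (hx : x ∈ slice C m y) (hx' : x' ∈ slice C m y') (ha : 0 ≤ a) (hb : 0 ≤ b) (hab : a + b = 1) :
    a * x + b * x' ∈ slice C m (a * y + b * y') := by
  have := hC hx hx' ha hb hab
  rw [combo_planePoint] at this
  change planePoint _ _ ∈ C
  convert this using 2; ring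

theorem convex_slice {C : Set Plane} (hC : Convex ℝ C) (m y : ℝ) : Convex ℝ (slice C m y) := by
  intro x hx x' hx' a b ha hb hab
  have := combo_mem_slice hC hx hx' ha hb hab
  rwa [← add_mul, hab, one_mul] at this

theorem isCompact_slice {C : Set Plane} (hC : IsCompact C) (m y : ℝ) :
    IsCompact (slice C m y) := by
  apply (hC.image (f := fun v : Plane => v 0) (by fun_prop)).of_isClosed_subset
    (isClosed_slice hC.isClosed m y)
  intro x hx
  exact ⟨_, hx, rfl⟩

theorem exists_slice_eq_Icc {C : Set Plane} (hC : IsCompact C) (hc : Convex ℝ C) {m y : ℝ}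
    (hne : (slice C m y).Nonempty) : ∃ l r, l ≤ r ∧ slice C m y = Icc l r ∧ chord C m y = r - l := by
  have h := eq_Icc_of_connected_compact ((convex_slice hc m y).isConnected hne)
    (isCompact_slice hC m y)
  have hle : sInf (slice C m y) ≤ sSup (slice C m y) := by
    rw [h] at hne; exact nonempty_Icc.1 hne
  refine ⟨_, _, hle, h, ?_⟩
  unfold chord
  conv_lhs => rw [h]
  rw [Real.volume_real_Icc_of_le hle]

theorem sub_le_chord {C : Set Plane} (hC : IsCompact C) (hc : Convex ℝ C) {m y l r : ℝ}
    (hl : l ∈ slice C m y) (hr : r ∈ slice C m y) : r - l ≤ chord C m y := by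
  obtain ⟨l', r', -, h, h'⟩ := exists_slice_eq_Icc hC hc ⟨l, hl⟩
  rw [h] at hl hr
  rw [h']; linarith [hl.1, hr.2]

theorem chord_eq_zero_of_empty {C : Set Plane} {m y : ℝ} (h : ¬ (slice C m y).Nonempty) :
    chord C m y = 0 := by
  rw [not_nonempty_iff_eq_empty] at h
  simp [chord, h]

/-- Planar Brunn–Minkowski: combining the left endpoints and the right endpoints of two slices gives
two points of the intermediate slice. -/
theorem concaveOn_chord {C : Set Plane} (hC : IsCompact C) (hc : Convex ℝ C) {m y₀ y₁ : ℝ}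
    (h : ∀ y ∈ Icc y₀ y₁, (slice C m y).Nonempty) : ConcaveOn ℝ (Icc y₀ y₁) (chord C m) := by
  refine ⟨convex_Icc _ _, fun y hy y' hy' a b ha hb hab => ?_⟩
  obtain ⟨l, r, hlr, e, e'⟩ := exists_slice_eq_Icc hC hc (h y hy)
  obtain ⟨l2, r2, hlr2, e2, e2'⟩ := exists_slice_eq_Icc hC hc (h y' hy')
  rw [e', e2']
  simp only [smul_eq_mul]
  have hl := combo_mem_slice hc (e ▸ left_mem_Icc.2 hlr) (e2 ▸ left_mem_Icc.2 hlr2) ha hb hab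
  have hr := combo_mem_slice hc (e ▸ right_mem_Icc.2 hlr) (e2 ▸ right_mem_Icc.2 hlr2) ha hb hab
  have := sub_le_chord hC hc hl hr
  linarith

/-- The levels `y` for which the line `x₁ = y + m x₀` meets `C` form a compact interval. -/
theorem exists_levels_eq_Icc {C : Set Plane} (hC : IsCompact C) (hc : Convex ℝ C)
    (hne : C.Nonempty) (m : ℝ) :
    ∃ y₀ y₁, y₀ ≤ y₁ ∧ ∀ y, (slice C m y).Nonempty ↔ y ∈ Icc y₀ y₁ := by
  set Y : Set ℝ := {y | (slice C m y).Nonempty} with hY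
  have hYe : Y = (fun v : Plane => v 1 - m * v 0) '' C := by
    ext y; constructor
    · rintro ⟨x, hx⟩; exact ⟨_, hx, by simp⟩
    · rintro ⟨v, hv, rfl⟩; exact ⟨_, mem_slice_self m hv⟩
  have hYc : IsCompact Y := hYe ▸ hC.image (by fun_prop)
  have hYconn : IsConnected Y := hYe ▸ (hc.isConnected hne).image _ (by fun_prop)
  have h := eq_Icc_of_connected_compact hYconn hYc
  refine ⟨sInf Y, sSup Y, ?_, fun y => ?_⟩
  · have := hYconn.nonempty; rw [h] at this; exact nonempty_Icc.1 this
  · rw [← h]; rfl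

/-- An endpoint of a chord is a boundary point. -/
theorem planePoint_mem_frontier {C : Set Plane} {m y l r x : ℝ}
    (h : slice C m y = Icc l r) (hlr : l ≤ r) (hx : x = l ∨ x = r) :
    planePoint x (y + m * x) ∈ frontier C := by
  have hxs : x ∈ slice C m y := by
    rw [h]; rcases hx with rfl | rfl
    · exact left_mem_Icc.2 hlr
    · exact right_mem_Icc.2 hlr
  refine ⟨subset_closure hxs, fun hint => ?_⟩
  have hcont : Continuous fun x : ℝ => planePoint x (y + m * x) := by fun_prop
  have hnhds : slice C m y ∈ 𝓝 x := by
    filter_upwards [hcont.continuousAt.preimage_mem_nhds (isOpen_interior.mem_nhds hint)] with z hz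
    exact interior_subset (s := C) hz
  have : x ∈ interior (slice C m y) := mem_interior_iff_mem_nhds.2 hnhds
  rw [h, interior_Icc] at this
  rcases hx with rfl | rfl
  · exact lt_irrefl _ this.1
  · exact lt_irrefl _ this.2

/-! ### The body near the origin is the epigraph of `|x| ^ γ` -/

theorem IsFlatBody.exists_graph_mem_frontier {γ : ℝ} {C : Set Plane} (hγ : 2 < γ)
    (hC : IsFlatBody γ C) :
    ∃ r > 0, ∀ x, |x| ≤ r → planePoint x (|x| ^ γ) ∈ frontier C := by
  obtain ⟨U, hU, h0, -, hfr, -⟩ := hC.boundary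
  have hcont : Continuous fun x : ℝ => planePoint x (|x| ^ γ) := by
    have : Continuous fun x : ℝ => |x| ^ γ :=
      continuous_abs.rpow_const fun x => Or.inr (by linarith)
    fun_prop
  have hz : planePoint 0 (|0| ^ γ) = 0 := by
    apply plane_ext
    · simp
    · simp [Real.zero_rpow (by linarith : γ ≠ 0)]
  have hn := hcont.continuousAt.preimage_mem_nhds (x := 0) (hU.mem_nhds (hz ▸ h0))
  obtain ⟨ε, hε, hb⟩ := Metric.mem_nhds_iff.1 hn
  refine ⟨ε / 2, by positivity, fun x hx => ?_⟩
  have hxU : planePoint x (|x| ^ γ) ∈ U := hb (by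
    rw [Metric.mem_ball, Real.dist_eq, sub_zero]; linarith)
  have : planePoint x (|x| ^ γ) ∈ {x : Plane | x 1 = |x 0| ^ γ} ∩ U := ⟨rfl, hxU⟩
  rw [← hfr] at this
  exact this.1

section Epigraph

variable {γ r : ℝ} {C : Set Plane}

/-- The point lies on the horizontal segment joining the two graph points `(±z, y)` with `z ^ γ =
y`. -/
theorem mem_of_epigraph (hγ : 2 < γ) (hC : IsClosed C) (hc : Convex ℝ C) (hr : 0 < r)
    (hg : ∀ x, |x| ≤ r → planePoint x (|x| ^ γ) ∈ frontier C) {x y : ℝ}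
    (h1 : |x| ^ γ ≤ y) (h2 : y ≤ r ^ γ) : planePoint x y ∈ C := by
  have hγ0 : 0 < γ := by linarith
  have hy : 0 ≤ y := (Real.rpow_nonneg (abs_nonneg x) γ).trans h1
  set z := y ^ γ⁻¹ with hz
  have hz0 : 0 ≤ z := Real.rpow_nonneg hy _
  have hzy : z ^ γ = y := Real.rpow_inv_rpow hy hγ0.ne'
  have hxz : |x| ≤ z := by
    rw [← Real.rpow_le_rpow_iff (abs_nonneg x) hz0 hγ0, hzy]; exact h1
  have hzr : z ≤ r := by
    rw [← Real.rpow_le_rpow_iff hz0 hr.le hγ0, hzy]; exact h2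
  have hp : z ∈ slice C 0 y := by
    have := hC.frontier_subset (hg z (by rwa [abs_of_nonneg hz0]))
    rw [abs_of_nonneg hz0, hzy] at this
    change planePoint _ _ ∈ C
    simpa using this
  have hm : -z ∈ slice C 0 y := by
    have := hC.frontier_subset (hg (-z) (by rwa [abs_neg, abs_of_nonneg hz0]))
    rw [abs_neg, abs_of_nonneg hz0, hzy] at this
    change planePoint _ _ ∈ C
    simpa using this
  have : x ∈ slice C 0 y := (convex_slice hc 0 y).ordConnected.out hm hp (abs_le.1 hxz)
  change planePoint _ _ ∈ C at this
  simpa using this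

/-- A point of `C` below the graph, joined to an interior point vertically above it, would put the
graph point between them in the interior, whereas it belongs to the frontier. -/
theorem epigraph_of_mem (hγ : 2 < γ) (hC : IsClosed C) (hc : Convex ℝ C) (hr : 0 < r)
    (hg : ∀ x, |x| ≤ r → planePoint x (|x| ^ γ) ∈ frontier C) {x y : ℝ}
    (hx : |x| < r) (hxy : planePoint x y ∈ C) : |x| ^ γ ≤ y := by
  by_contra! hlt
  have hxr : |x| ^ γ < r ^ γ := Real.rpow_lt_rpow (abs_nonneg x) hx (by linarith)
  set V : Set Plane := {v | |v 0| ^ γ < v 1} ∩ {v | v 1 < r ^ γ} with hV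
  have hVo : IsOpen V := by
    apply IsOpen.inter
    · apply isOpen_lt _ (by fun_prop)
      exact (by fun_prop : Continuous fun v : Plane => |v 0|).rpow_const
        fun _ => Or.inr (by linarith)
    · exact isOpen_lt (by fun_prop) continuous_const
  have hVC : V ⊆ interior C := by
    apply interior_maximal _ hVo
    rintro v ⟨h1, h2⟩
    rw [← planePoint_eta v]
    exact mem_of_epigraph hγ hC hc hr hg (le_of_lt h1) (le_of_lt h2)
  set w := (|x| ^ γ + r ^ γ) / 2 with hw
  have hz : planePoint x w ∈ interior C := hVC
    ⟨show |x| ^ γ < w by rw [hw]; linarith, show w < r ^ γ by rw [hw]; linarith⟩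
  have hyw : 0 < w - y := by rw [hw]; linarith
  have hin := hc.combo_interior_self_mem_interior hz hxy
    (a := (|x| ^ γ - y) / (w - y)) (b := (w - |x| ^ γ) / (w - y))
    (div_pos (by linarith) hyw) (div_nonneg (by rw [hw]; linarith) hyw.le)
    (by field_simp; ring)
  rw [combo_planePoint] at hin
  have e1 : (|x| ^ γ - y) / (w - y) * x + (w - |x| ^ γ) / (w - y) * x = x := by
    field_simp; ring
  have e2 : (|x| ^ γ - y) / (w - y) * w + (w - |x| ^ γ) / (w - y) * y = |x| ^ γ := by
    field_simp; ring
  rw [e1, e2] at hin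
  exact (hg x hx.le).2 hin

end Epigraph

/-! ### Long chords near the flat point -/

theorem tangent_le_of_deriv2_nonneg {φ φ' φ'' : ℝ → ℝ} {p q x₀ x : ℝ}
    (h1 : ∀ z ∈ Icc p q, HasDerivAt φ (φ' z) z) (h2 : ∀ z ∈ Icc p q, HasDerivAt φ' (φ'' z) z)
    (h3 : ∀ z ∈ Icc p q, 0 ≤ φ'' z) (hx₀ : x₀ ∈ Icc p q) (hx : x ∈ Icc p q) :
    φ x₀ + φ' x₀ * (x - x₀) ≤ φ x := by
  have hconv : ConvexOn ℝ (Icc p q) φ := by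
    apply convexOn_of_hasDerivWithinAt2_nonneg (convex_Icc p q)
      (fun z hz => (h1 z hz).continuousAt.continuousWithinAt)
      (fun z hz => (h1 z (interior_subset hz)).hasDerivWithinAt)
      (fun z hz => (h2 z (interior_subset hz)).hasDerivWithinAt)
      (fun z hz => h3 z (interior_subset hz))
  rcases lt_trichotomy x₀ x with h | h | h
  · have := hconv.le_slope_of_hasDerivAt hx₀ hx h (h1 x₀ hx₀)
    rw [slope_def_field, le_div_iff₀ (by linarith)] at this
    linarith
  · subst h; simp
  · have := hconv.slope_le_of_hasDerivAt hx hx₀ h (h1 x₀ hx₀)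
    rw [slope_def_field, div_le_iff₀ (by linarith)] at this
    linarith

/-- The functions `z ^ γ - l * z ^ 2` and `u * z ^ 2 - z ^ γ` are convex on the interval, so each
lies above its tangent at `x₀`. -/
theorem rpow_taylor_bounds {γ p q l u x₀ x : ℝ} (hp : 0 < p)
    (hl : ∀ z ∈ Icc p q, 2 * l ≤ γ * (γ - 1) * z ^ (γ - 2))
    (hu : ∀ z ∈ Icc p q, γ * (γ - 1) * z ^ (γ - 2) ≤ 2 * u)
    (hx₀ : x₀ ∈ Icc p q) (hx : x ∈ Icc p q) :
    l * (x - x₀) ^ 2 ≤ x ^ γ - x₀ ^ γ - γ * x₀ ^ (γ - 1) * (x - x₀) ∧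
    x ^ γ - x₀ ^ γ - γ * x₀ ^ (γ - 1) * (x - x₀) ≤ u * (x - x₀) ^ 2 := by
  have d1 : ∀ z ∈ Icc p q, HasDerivAt (fun z : ℝ => z ^ γ) (γ * z ^ (γ - 1)) z := fun z hz =>
    Real.hasDerivAt_rpow_const (Or.inl (lt_of_lt_of_le hp hz.1).ne')
  have d2 : ∀ z ∈ Icc p q,
      HasDerivAt (fun z : ℝ => γ * z ^ (γ - 1)) (γ * (γ - 1) * z ^ (γ - 2)) z := fun z hz => by
    have := (Real.hasDerivAt_rpow_const (p := γ - 1)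
      (Or.inl (lt_of_lt_of_le hp hz.1).ne')).const_mul γ
    refine this.congr_deriv ?_
    rw [show γ - 1 - 1 = γ - 2 by ring]; ring
  have s1 : ∀ k z : ℝ, HasDerivAt (fun z : ℝ => k * z ^ 2) (k * (2 * z)) z := fun k z => by
    simpa using (hasDerivAt_pow 2 z).const_mul k
  have s2 : ∀ k z : ℝ, HasDerivAt (fun z : ℝ => k * (2 * z)) (2 * k) z := fun k z => by
    exact (((hasDerivAt_id z).const_mul 2).const_mul k).congr_deriv (by ring)
  constructor
  · have := tangent_le_of_deriv2_nonneg (fun z hz => (d1 z hz).sub (s1 l z))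
      (fun z hz => (d2 z hz).sub (s2 l z)) (fun z hz => sub_nonneg.2 (hl z hz)) hx₀ hx
    simp only [Pi.sub_apply] at this
    linarith
  · have := tangent_le_of_deriv2_nonneg (fun z hz => (s1 u z).sub (d1 z hz))
      (fun z hz => (s2 u z).sub (d2 z hz)) (fun z hz => sub_nonneg.2 (hu z hz)) hx₀ hx
    simp only [Pi.sub_apply] at this
    linarith

/-- Chords close to a point of contact `(x₀, x₀ ^ γ)` where the curve `|x| ^ γ` is pinched between
two parabolas. -/
theorem chord_bounds_of_parabolas {γ r : ℝ} {C : Set Plane} (hγ : 2 < γ) (hC : IsCompact C)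
    (hc : Convex ℝ C) (hr : 0 < r) (hg : ∀ x, |x| ≤ r → planePoint x (|x| ^ γ) ∈ frontier C)
    {x₀ d m l u q : ℝ} (hd : 0 < d) (hdx : d < x₀) (hq : x₀ + d ≤ q) (hqr : q < r) (hl : 0 < l)
    (hlu : l ≤ u) (hul : u ≤ 1.232 * l)
    (h : ∀ x, |x - x₀| ≤ d → l * (x - x₀) ^ 2 ≤ x ^ γ - x₀ ^ γ - m * (x - x₀) ∧
      x ^ γ - x₀ ^ γ - m * (x - x₀) ≤ u * (x - x₀) ^ 2) :
    (∀ y, (slice C m y).Nonempty → x₀ ^ γ - m * x₀ ≤ y) ∧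
    ∀ s ∈ Icc 0 (min (l * d ^ 2 / 2) (r ^ γ - q ^ γ)),
      (slice C m (x₀ ^ γ - m * x₀ + s)).Nonempty ∧
      2 / √u * √s ≤ chord C m (x₀ ^ γ - m * x₀ + s) ∧
      chord C m (x₀ ^ γ - m * x₀ + s) ≤ 1.11 * (2 / √u) * √s := by
  set y₀ := x₀ ^ γ - m * x₀ with hy₀
  have habs : ∀ x, |x - x₀| ≤ d → |x| = x ∧ 0 ≤ x ∧ x ≤ q := fun x hx => by
    obtain ⟨h1, h2⟩ := abs_le.1 hx
    exact ⟨abs_of_nonneg (by linarith), by linarith, by linarith⟩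
  have hbelow : ∀ x y, |x - x₀| ≤ d → x ∈ slice C m y → l * (x - x₀) ^ 2 ≤ y - y₀ := by
    intro x y hx hxy
    obtain ⟨e, -, e2⟩ := habs x hx
    have := epigraph_of_mem hγ hC.isClosed hc hr hg (by rw [e]; linarith) hxy
    rw [e] at this
    have := (h x hx).1
    rw [hy₀]; linarith
  have hu : 0 < u := by linarith
  have hx₀s : x₀ ∈ slice C m y₀ := by
    have := hC.isClosed.frontier_subset (hg x₀ (by rw [abs_of_pos] <;> linarith))
    rw [abs_of_pos (by linarith)] at this
    change planePoint _ _ ∈ C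
    rwa [hy₀, sub_add_cancel]
  refine ⟨?_, ?_⟩
  · rintro y ⟨x, hx⟩
    by_contra! hlt
    have hden : 0 < |x - x₀| + d := by positivity
    -- A point of `C` below the tangent line is contracted towards the contact point until it enters
    -- the window of radius `d`, where the lower parabola excludes it.
    set t := d / (|x - x₀| + d) with ht
    have ht0 : 0 < t := by positivity
    have ht1 : t ≤ 1 := by rw [ht, div_le_one hden]; linarith [abs_nonneg (x - x₀)]
    have hmem := combo_mem_slice hc hx hx₀s ht0.le (sub_nonneg.2 ht1) (by ring)
    have := hbelow _ _ (by
      rw [show t * x + (1 - t) * x₀ - x₀ = t * (x - x₀) by ring, abs_mul, abs_of_pos ht0, ht,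
        div_mul_eq_mul_div, div_le_iff₀ hden]
      nlinarith [abs_nonneg (x - x₀)]) hmem
    have h1 : 0 ≤ l * (t * x + (1 - t) * x₀ - x₀) ^ 2 := by positivity
    have h2 : t * (y - y₀) < 0 := mul_neg_of_pos_of_neg ht0 (by linarith)
    linarith
  · rintro s ⟨hs0, hs1⟩
    -- The first bound on `s` keeps the half-width `√(s / l)` strictly below `d`; the second keeps
    -- the points under consideration below height `r ^ γ`, as `mem_of_epigraph` requires.
    have hs2 : s ≤ l * d ^ 2 / 2 := hs1.trans (min_le_left _ _)
    have hs3 : s ≤ r ^ γ - q ^ γ := hs1.trans (min_le_right _ _)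
    have hin : ∀ x, |x - x₀| ≤ d → u * (x - x₀) ^ 2 ≤ s → x ∈ slice C m (y₀ + s) := by
      intro x hx hxs
      obtain ⟨e, e1, e2⟩ := habs x hx
      have h2 := (h x hx).2
      have h1 := (h x hx).1
      have h3 : 0 ≤ l * (x - x₀) ^ 2 := by positivity
      apply mem_of_epigraph hγ hC.isClosed hc hr hg
      · rw [e, hy₀]; linarith
      · have : x ^ γ ≤ q ^ γ := Real.rpow_le_rpow e1 e2 (by linarith)
        rw [hy₀]; linarith
    have hwu : √(s / u) ≤ d := by
      rw [Real.sqrt_le_left hd.le, div_le_iff₀ hu]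
      nlinarith [sq_nonneg d]
    have hsu : u * √(s / u) ^ 2 = s := by
      rw [Real.sq_sqrt (by positivity)]; field_simp
    have hx₀s' : x₀ ∈ slice C m (y₀ + s) := hin x₀ (by simpa using hd.le) (by simpa using hs0)
    refine ⟨⟨x₀, hx₀s'⟩, ?_, ?_⟩
    · have h1 := hin (x₀ + √(s / u)) (by
        rw [add_sub_cancel_left, abs_of_nonneg (Real.sqrt_nonneg _)]; exact hwu) (by
        rw [add_sub_cancel_left]; exact hsu.le)
      have h2 := hin (x₀ - √(s / u)) (by
        rw [sub_sub_cancel_left, abs_neg, abs_of_nonneg (Real.sqrt_nonneg _)]; exact hwu) (by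
        rw [sub_sub_cancel_left, neg_sq]; exact hsu.le)
      have := sub_le_chord hC hc h2 h1
      rw [Real.sqrt_div hs0] at this
      calc 2 / √u * √s = x₀ + √s / √u - (x₀ - √s / √u) := by ring
        _ ≤ _ := this
    · set w := √(s / l) with hw
      have hw0 : 0 ≤ w := Real.sqrt_nonneg _
      have hwd : w < d := by
        rw [hw, Real.sqrt_lt' hd, div_lt_iff₀ hl]
        have : 0 < l * d ^ 2 := by positivity
        linarith
      have hsw : l * w ^ 2 = s := by
        rw [hw, Real.sq_sqrt (by positivity)]; field_simp
      -- Only offsets up to `d` are controlled directly; a farther point of the slice is excluded by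
      -- convexity, which would also put the offset truncated to `d` in the slice.
      have key : ∀ t, w < t → t ≤ d →
          x₀ + t ∉ slice C m (y₀ + s) ∧ x₀ - t ∉ slice C m (y₀ + s) := by
        intro t ht htd
        have hlt : l * w ^ 2 < l * t ^ 2 :=
          mul_lt_mul_of_pos_left (pow_lt_pow_left₀ ht hw0 (by norm_num)) hl
        constructor
        · intro hmem
          have := hbelow _ _ (by
            rw [add_sub_cancel_left, abs_of_nonneg (by linarith)]; exact htd) hmem
          rw [add_sub_cancel_left] at this
          linarith
        · intro hmem
          have := hbelow _ _ (by
            rw [sub_sub_cancel_left, abs_neg, abs_of_nonneg (by linarith)]; exact htd) hmem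
          rw [sub_sub_cancel_left, neg_sq] at this
          linarith
      have hsub : slice C m (y₀ + s) ⊆ Icc (x₀ - w) (x₀ + w) := by
        intro x hx
        have hoc := (convex_slice hc m (y₀ + s)).ordConnected
        constructor
        · by_contra! hlt
          refine (key (min d (x₀ - x)) (lt_min hwd (by linarith)) (min_le_left _ _)).2
            (hoc.out hx hx₀s' ⟨by linarith [min_le_right d (x₀ - x)], ?_⟩)
          linarith [lt_min hwd (by linarith : w < x₀ - x)]
        · by_contra! hlt
          refine (key (min d (x - x₀)) (lt_min hwd (by linarith)) (min_le_left _ _)).1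
            (hoc.out hx₀s' hx ⟨?_, by linarith [min_le_right d (x - x₀)]⟩)
          linarith [lt_min hwd (by linarith : w < x - x₀)]
      have hch : chord C m (y₀ + s) ≤ 2 * w := by
        have := measureReal_mono (μ := volume) hsub (by simp)
        rw [Real.volume_real_Icc_of_le (by linarith)] at this
        unfold chord; linarith
      refine hch.trans ?_
      -- This is where `1.232` comes from: `1.11 ^ 2 = 1.2321`.
      have hsl : √u ≤ 1.11 * √l := by
        rw [Real.sqrt_le_left (by positivity), mul_pow, Real.sq_sqrt hl.le]
        norm_num at *; linarith
      have hul0 : 0 < √u := Real.sqrt_pos.2 hu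
      have hl0 : 0 < √l := Real.sqrt_pos.2 hl
      rw [hw, Real.sqrt_div hs0]
      have : 1 / √l ≤ 1.11 / √u := by rw [div_le_div_iff₀ hl0 hul0]; linarith
      calc 2 * (√s / √l) = 2 * √s * (1 / √l) := by ring
        _ ≤ 2 * √s * (1.11 / √u) := mul_le_mul_of_nonneg_left this (by positivity)
        _ = _ := by ring

/-- The curvature at abscissa `ξ` tends to `0` with `ξ`, so the chord constant can exceed any `M`,
with slopes as small as desired. The point `ξ` stays positive: there the curvature is almost
constant locally and the tangent slopes sweep a genuine interval. -/
theorem exists_bottom_chord_bounds {γ r : ℝ} {C : Set Plane} (hγ : 2 < γ) (hC : IsCompact C)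
    (hc : Convex ℝ C) (hr : 0 < r) (hg : ∀ x, |x| ≤ r → planePoint x (|x| ^ γ) ∈ frontier C)
    (M : ℝ) {m₀ : ℝ} (hm₀ : 0 < m₀) :
    ∃ m₁ m₂, 0 < m₁ ∧ m₁ < m₂ ∧ m₂ ≤ m₀ ∧ ∃ c, M ≤ c ∧ 0 < c ∧ ∃ δ > 0, ∀ m ∈ Icc m₁ m₂, ∃ y₀,
      (∀ y, (slice C m y).Nonempty → y₀ ≤ y) ∧ ∀ s ∈ Icc 0 δ, (slice C m (y₀ + s)).Nonempty ∧
        c * √s ≤ chord C m (y₀ + s) ∧ chord C m (y₀ + s) ≤ 1.11 * c * √s := by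
  have hγ2 : 0 < γ - 2 := by linarith
  set ν : ℝ → ℝ := fun z => γ * (γ - 1) * z ^ (γ - 2) with hν
  have hνc : Continuous ν := by
    apply Continuous.mul continuous_const
    exact Real.continuous_rpow_const hγ2.le
  have hmc : Continuous fun z : ℝ => γ * (2 * z) ^ (γ - 1) := by
    apply Continuous.mul continuous_const
    exact (by fun_prop : Continuous fun z : ℝ => 2 * z).rpow_const fun _ => Or.inr (by linarith)
  have hev1 : ∀ᶠ z in 𝓝 (0 : ℝ), γ * (2 * z) ^ (γ - 1) < m₀ := by
    apply hmc.continuousAt.eventually_lt continuousAt_const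
    simpa [Real.zero_rpow (by linarith : γ - 1 ≠ 0)] using hm₀
  -- This amounts to `2 / √u > |M| + 1` for the later choice `u = 0.55 * ν ξ`; it uses `γ > 2`.
  have hev2 : ∀ᶠ z in 𝓝 (0 : ℝ), 0.55 * ν z * (|M| + 1) ^ 2 < 4 := by
    apply ContinuousAt.eventually_lt (by fun_prop) continuousAt_const
    simp [hν, Real.zero_rpow hγ2.ne']
  have hev3 : ∀ᶠ z in 𝓝 (0 : ℝ), 2 * z < r :=
    ContinuousAt.eventually_lt (by fun_prop) continuousAt_const (by simpa using hr)
  obtain ⟨ξ, hξ, hξ1, hξ2, hξ3⟩ : ∃ ξ : ℝ, 0 < ξ ∧ γ * (2 * ξ) ^ (γ - 1) < m₀ ∧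
      0.55 * ν ξ * (|M| + 1) ^ 2 < 4 ∧ 2 * ξ < r := by
    have := (((hev1.and (hev2.and hev3)).filter_mono nhdsWithin_le_nhds).and
      (self_mem_nhdsWithin (s := Ioi (0 : ℝ)))).exists
    obtain ⟨ξ, ⟨h1, h2, h3⟩, h0⟩ := this
    exact ⟨ξ, h0, h1, h2, h3⟩
  have hνξ : 0 < ν ξ := by
    have : 0 < γ - 1 := by linarith
    have : 0 < γ := by linarith
    simp only [hν]; positivity
  have hloc : ∀ᶠ z in 𝓝 ξ, 0.9 * ν ξ < ν z ∧ ν z < 1.1 * ν ξ := by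
    apply Filter.Eventually.and
    · exact continuousAt_const.eventually_lt hνc.continuousAt (by linarith)
    · exact hνc.continuousAt.eventually_lt continuousAt_const (by linarith)
  obtain ⟨ε, hε, hball⟩ := Metric.eventually_nhds_iff.1 hloc
  -- Contact points range over `ξ ± d` and each needs a window of radius `d`, so the curvature is
  -- controlled on `ξ ± 2 * d`.
  set d := min (ε / 4) (ξ / 4) with hd
  have hd0 : 0 < d := by positivity
  have hdε : d ≤ ε / 4 := min_le_left _ _
  have hdξ : d ≤ ξ / 4 := min_le_right _ _
  have hwin : ∀ z ∈ Icc (ξ - 2 * d) (ξ + 2 * d), 0.9 * ν ξ < ν z ∧ ν z < 1.1 * ν ξ := by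
    intro z hz
    apply hball
    rw [Real.dist_eq]
    exact (abs_le.2 ⟨by linarith [hz.1], by linarith [hz.2]⟩ : |z - ξ| ≤ 2 * d).trans_lt
      (by linarith)
  have hγ0 : 0 < γ := by linarith
  -- Half of `0.9 * ν ξ` and, for `u`, half of `1.1 * ν ξ`; their ratio `11 / 9` is below `1.232`.
  set l := 0.45 * ν ξ with hl
  set u := 0.55 * ν ξ with hu
  have hl0 : 0 < l := by positivity
  have hu0 : 0 < u := by positivity
  have hlt : (ξ - d) ^ (γ - 1) < (ξ + d) ^ (γ - 1) :=
    Real.rpow_lt_rpow (by linarith) (by linarith) (by linarith)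
  have hrq : (2 * ξ) ^ γ < r ^ γ := Real.rpow_lt_rpow (by linarith) hξ3 hγ0
  refine ⟨γ * (ξ - d) ^ (γ - 1), γ * (ξ + d) ^ (γ - 1), ?_, ?_, ?_, 2 / √u, ?_, by positivity,
    min (l * d ^ 2 / 2) (r ^ γ - (2 * ξ) ^ γ), ?_, ?_⟩
  · have : 0 < ξ - d := by linarith
    positivity
  · exact mul_lt_mul_of_pos_left hlt hγ0
  · refine le_trans ?_ hξ1.le
    apply mul_le_mul_of_nonneg_left _ hγ0.le
    exact Real.rpow_le_rpow (by linarith) (by linarith) (by linarith)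
  · rw [le_div_iff₀ (Real.sqrt_pos.2 hu0)]
    have h1 : √u * (|M| + 1) ≤ 2 := by
      refine (abs_le_of_sq_le_sq' ?_ (by norm_num)).2
      rw [mul_pow, Real.sq_sqrt hu0.le]; linarith
    have h2 : M * √u ≤ (|M| + 1) * √u :=
      mul_le_mul_of_nonneg_right (by linarith [le_abs_self M]) (Real.sqrt_nonneg _)
    linarith
  · have : 0 < r ^ γ - (2 * ξ) ^ γ := by linarith
    positivity
  · intro m hm
    have hcont : ContinuousOn (fun z : ℝ => γ * z ^ (γ - 1)) (Icc (ξ - d) (ξ + d)) :=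
      (continuous_const.mul (Real.continuous_rpow_const (by linarith))).continuousOn
    obtain ⟨x₀, hx₀, hmx⟩ := intermediate_value_Icc (by linarith) hcont hm
    refine ⟨x₀ ^ γ - m * x₀, ?_⟩
    refine chord_bounds_of_parabolas hγ hC hc hr hg (d := d) (q := 2 * ξ) (l := l) (u := u) hd0
      (by linarith [hx₀.1]) (by linarith [hx₀.2]) hξ3 hl0 ?_ ?_ ?_
    · rw [hl, hu]; linarith
    · rw [hl, hu]; linarith
    · intro x hx
      obtain ⟨h1, h2⟩ := abs_le.1 hx
      have := rpow_taylor_bounds (γ := γ) (p := ξ - 2 * d) (q := ξ + 2 * d) (l := l) (u := u)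
        (x₀ := x₀) (x := x) (by linarith) (fun z hz => by rw [hl]; linarith [(hwin z hz).1])
        (fun z hz => by rw [hu]; linarith [(hwin z hz).2])
        ⟨by linarith [hx₀.1], by linarith [hx₀.2]⟩ ⟨by linarith [hx₀.1], by linarith [hx₀.2]⟩
      simp only at hmx
      rwa [hmx] at this

/-! ### Short chords near the top -/

theorem abs_apply_le_norm (v : Plane) (i : Fin 2) : |v i| ≤ ‖v‖ := by
  simpa using PiLp.norm_apply_le v i

theorem norm_planePoint_le (x y : ℝ) : ‖planePoint x y‖ ≤ |x| + |y| := by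
  rw [EuclideanSpace.norm_eq, Real.sqrt_le_left (by positivity)]
  simp only [Fin.sum_univ_two, planePoint_zero, planePoint_one, Real.norm_eq_abs]
  nlinarith [abs_nonneg x, abs_nonneg y]

theorem not_mem_interior_of_isMaxOn {C : Set Plane} {P : Plane} {m : ℝ}
    (hmax : ∀ v ∈ C, v 1 - m * v 0 ≤ P 1 - m * P 0) : P ∉ interior C := by
  intro hP
  have hc : Continuous fun t : ℝ => planePoint (P 0) (P 1 + t) := by fun_prop
  have h0 : planePoint (P 0) (P 1 + 0) = P := by rw [add_zero, planePoint_eta]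
  have hn := hc.continuousAt.preimage_mem_nhds (x := 0)
    (isOpen_interior.mem_nhds (h0.symm ▸ hP))
  obtain ⟨ε, hε, hb⟩ := Metric.mem_nhds_iff.1 hn
  have : ε / 2 ∈ Metric.ball (0 : ℝ) ε := by
    rw [Metric.mem_ball, Real.dist_eq, sub_zero, abs_of_pos] <;> linarith
  have hmem : planePoint (P 0) (P 1 + ε / 2) ∈ interior C := hb this
  have := hmax _ (interior_subset hmem)
  simp at this
  linarith

/-- Near a highest point where the boundary has positive curvature, the boundary is uniformly
strongly concave with respect to all nearly vertical directions. -/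
theorem SmoothWithCurvatureGE.sq_le_of_isMax {C : Set Plane} (hC : IsClosed C) {κ : ℝ} (hκ : 0 < κ)
    {P : Plane} (hmax : ∀ v ∈ C, v 1 ≤ P 1)
    (hs : SmoothWithCurvatureGE (frontier C) κ P) :
    ∃ r > 0, ∃ m₀ > 0, ∀ m, |m| ≤ m₀ → ∀ Y, (∀ w ∈ C, w 1 - m * w 0 ≤ Y) →
      ∀ v ∈ frontier C, ∀ v' ∈ frontier C, ‖v - P‖ < r → ‖v' - P‖ < r → ∀ s,
        v 1 - m * v 0 = Y - s → v' 1 - m * v' 0 = Y - s → κ * (v 0 - v' 0) ^ 2 ≤ 64 * s := by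
  obtain ⟨e, f, hf, hf0, hf1, hf2, hloc⟩ := hs
  obtain ⟨η, hη, hloc⟩ := Metric.eventually_nhds_iff.1 hloc
  have hfd : ContDiff ℝ ∞ (deriv f) := (contDiff_infty_iff_deriv.1 hf).2
  have hfdd : ContDiff ℝ ∞ (deriv (deriv f)) := (contDiff_infty_iff_deriv.1 hfd).2
  have D1 : ∀ z, HasDerivAt f (deriv f z) z := fun z =>
    ((contDiff_infty_iff_deriv.1 hf).1 z).hasDerivAt
  have D2 : ∀ z, HasDerivAt (deriv f) (deriv (deriv f) z) z := fun z =>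
    ((contDiff_infty_iff_deriv.1 hfd).1 z).hasDerivAt
  set E₀ := planePoint 1 0 with hE₀
  set E₁ := planePoint 0 1 with hE₁
  have hdec : ∀ v : Plane, ∀ i, e v i = v 0 * e E₀ i + v 1 * e E₁ i := fun v i => by
    have hv : v = v 0 • E₀ + v 1 • E₁ := by apply plane_ext <;> simp [hE₀, hE₁]
    conv_lhs => rw [hv]
    simp
  have hA : ∀ i, |e E₀ i| ≤ 1 := fun i => (abs_apply_le_norm _ i).trans (by
    rw [e.norm_map]; simpa using norm_planePoint_le 1 0)
  have hB : ∀ i, |e E₁ i| ≤ 1 := fun i => (abs_apply_le_norm _ i).trans (by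
    rw [e.norm_map]; simpa using norm_planePoint_le 0 1)
  have hfr : ∀ t, |t| + |f t| < η → P + e (planePoint t (f t)) ∈ frontier C := fun t ht => by
    refine (hloc (y := planePoint t (f t)) ?_).2 rfl
    rw [dist_zero_right]
    exact (norm_planePoint_le _ _).trans_lt ht
  have hsmall : ∀ᶠ t in 𝓝 (0 : ℝ), |t| + |f t| < η := by
    apply ContinuousAt.eventually_lt _ continuousAt_const (by simpa [hf0] using hη)
    exact (continuous_abs.add hf.continuous.abs).continuousAt
  -- the tangent at `P` is horizontal
  set φ : ℝ → ℝ := fun t => e E₀ 1 * t + e E₁ 1 * f t with hφ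
  have hφmax : IsLocalMax φ 0 := by
    filter_upwards [hsmall] with t ht
    have h1 := hmax _ (hC.frontier_subset (hfr t ht))
    have h2 := hdec (planePoint t (f t)) 1
    simp only [PiLp.add_apply, planePoint_zero, planePoint_one] at h1 h2
    simp only [hφ, hf0]
    linarith
  have hA1 : e E₀ 1 = 0 := by
    have hd : HasDerivAt φ (e E₀ 1 * 1 + e E₁ 1 * deriv f 0) 0 :=
      ((hasDerivAt_id (0 : ℝ)).const_mul _).add ((D1 0).const_mul _)
    have := hφmax.hasDerivAt_eq_zero hd
    simpa [hf1] using this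
  have hB1 : 1 ≤ |e E₁ 1| := by
    have h1 := hdec (e.symm E₁) 1
    rw [e.apply_symm_apply, hA1] at h1
    have h2 : |e.symm E₁ 1| ≤ 1 := (abs_apply_le_norm _ 1).trans (by
      rw [e.symm.norm_map]; simpa using norm_planePoint_le 0 1)
    have h3 : (1 : ℝ) = e.symm E₁ 1 * e E₁ 1 := by simpa [hE₁] using h1
    have h4 : (1 : ℝ) = |e.symm E₁ 1| * |e E₁ 1| := by rw [← abs_mul, ← h3, abs_one]
    rw [h4]
    exact mul_le_of_le_one_left (abs_nonneg _) h2
  have hφe : φ = fun t => e E₁ 1 * f t := by funext t; simp [hφ, hA1]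
  have hdφ : deriv φ = fun t => e E₁ 1 * deriv f t := by
    rw [hφe]; funext t; exact ((D1 t).const_mul _).deriv
  have hddφ : deriv (deriv φ) 0 = e E₁ 1 * deriv (deriv f) 0 := by
    rw [hdφ]; exact ((D2 0).const_mul _).deriv
  -- A positive second derivative would make `0` both a local minimum and a local maximum of `φ`,
  -- hence `φ` locally constant, a contradiction.
  have hsign : e E₁ 1 * deriv (deriv f) 0 ≤ 0 := by
    by_contra! hpos
    have hmin : IsLocalMin φ 0 := by
      apply isLocalMin_of_deriv_deriv_pos (hddφ ▸ hpos)
      · rw [hdφ]; simp [hf1]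
      · rw [hφe]; exact (continuous_const.mul hf.continuous).continuousAt
    have hconst : φ =ᶠ[𝓝 0] fun _ => φ 0 := by
      filter_upwards [hmin, hφmax] with t h1 h2 using le_antisymm h2 h1
    have := hconst.deriv.deriv_eq
    rw [hddφ] at this
    simp at this
    rcases this with h | h <;> simp [h] at hpos
  have hneg : e E₁ 1 * deriv (deriv f) 0 ≤ -κ := by
    have h0 := abs_of_nonpos hsign
    rw [abs_mul] at h0
    have : 1 * κ ≤ |e E₁ 1| * |deriv (deriv f) 0| := mul_le_mul hB1 hf2 hκ.le (abs_nonneg _)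
    linarith
  -- uniform bounds near `P`
  have hev1 : ∀ᶠ q : ℝ × ℝ in 𝓝 (0, 0),
      (e E₁ 1 - q.1 * e E₁ 0) * deriv (deriv f) q.2 < -(κ / 2) := by
    have hcd := hfdd.continuous
    apply ContinuousAt.eventually_lt (by fun_prop) continuousAt_const
    simp only [zero_mul, sub_zero]
    linarith
  have hev2 : ∀ᶠ q : ℝ × ℝ in 𝓝 (0, 0), |deriv f q.2| < 1 := by
    have hcd := hfd.continuous
    exact ContinuousAt.eventually_lt (by fun_prop) continuousAt_const (by simp [hf1])
  have hev3 : ∀ᶠ q : ℝ × ℝ in 𝓝 (0, 0), |q.2| + |f q.2| < η := by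
    have hcd := hf.continuous
    exact ContinuousAt.eventually_lt (by fun_prop) continuousAt_const (by simpa [hf0] using hη)
  obtain ⟨ε, hε, hball⟩ := Metric.eventually_nhds_iff.1 (hev1.and (hev2.and hev3))
  have hb : ∀ m t : ℝ, |m| ≤ ε / 2 → |t| < ε →
      (e E₁ 1 - m * e E₁ 0) * deriv (deriv f) t < -(κ / 2) ∧ |deriv f t| < 1 ∧
        |t| + |f t| < η := fun m t hm ht => by
    refine hball (y := (m, t)) ?_
    rw [Prod.dist_eq, Real.dist_eq, Real.dist_eq, sub_zero, sub_zero]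
    exact max_lt (by linarith) ht
  refine ⟨min η ε, lt_min hη hε, ε / 2, by positivity, ?_⟩
  intro m hm Y hY v hv v' hv' hvr hvr' s hvs hvs'
  have hrep : ∀ v ∈ frontier C, ‖v - P‖ < min η ε →
      ∃ t, |t| < ε ∧ v = P + e (planePoint t (f t)) := by
    intro v hv hvr
    have hn : ‖e.symm (v - P)‖ < min η ε := by rwa [e.symm.norm_map]
    have h1 := (hloc (y := e.symm (v - P))
      (by rw [dist_zero_right]; exact hn.trans_le (min_le_left _ _))).1 (by simpa using hv)
    refine ⟨e.symm (v - P) 0, (abs_apply_le_norm _ _).trans_lt (hn.trans_le (min_le_right _ _)), ?_⟩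
    rw [← h1, planePoint_eta]; simp
  obtain ⟨t, ht, rfl⟩ := hrep v hv hvr
  obtain ⟨t', ht', rfl⟩ := hrep v' hv' hvr'
  obtain ⟨a1, a2⟩ := abs_lt.1 ht
  obtain ⟨b1, b2⟩ := abs_lt.1 ht'
  set u := (t + t') / 2 with hu
  have hp : ∀ t i, (P + e (planePoint t (f t))) i = P i + (t * e E₀ i + f t * e E₁ i) :=
    fun t i => by rw [PiLp.add_apply, hdec]; rfl
  rw [hp, hp] at hvs hvs'
  rw [hp, hp]
  have hIcc : ∀ z ∈ Icc (min t t') (max t t'), |z| < ε := fun z hz =>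
    abs_lt.2 ⟨(lt_min a1 b1).trans_le hz.1, hz.2.trans_lt (max_lt a2 b2)⟩
  have htI : t ∈ Icc (min t t') (max t t') := ⟨min_le_left _ _, le_max_left _ _⟩
  have htI' : t' ∈ Icc (min t t') (max t t') := ⟨min_le_right _ _, le_max_right _ _⟩
  have huI : u ∈ Icc (min t t') (max t t') := by
    constructor
    · rw [hu]; linarith [min_le_left t t', min_le_right t t']
    · rw [hu]; linarith [le_max_left t t', le_max_right t t']
  have hmid := hY _ (hC.frontier_subset (hfr u (hb m u hm (hIcc u huI)).2.2))
  rw [hp, hp] at hmid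
  set β := e E₁ 1 - m * e E₁ 0 with hβ
  -- Up to an affine term, `-(β * f z)` is minus the level of the boundary point with parameter `z`.
  -- Convexity of `ψ` says that this level is strongly concave, uniformly in small `m`.
  set ψ : ℝ → ℝ := fun z => -(β * f z) - κ / 4 * z ^ 2 with hψ
  have d1 : ∀ z ∈ Icc (min t t') (max t t'),
      HasDerivAt ψ (-(β * deriv f z) - κ / 4 * (2 * z)) z := fun z _ => by
    exact (((D1 z).const_mul β).neg.sub ((hasDerivAt_pow 2 z).const_mul (κ / 4))).congr_deriv
      (by norm_num)
  have d2 : ∀ z ∈ Icc (min t t') (max t t'),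
      HasDerivAt (fun z => -(β * deriv f z) - κ / 4 * (2 * z))
        (-(β * deriv (deriv f) z) - κ / 2) z := fun z _ =>
    (((D2 z).const_mul β).neg.sub
      (((hasDerivAt_id z).const_mul 2).const_mul (κ / 4))).congr_deriv (by ring)
  have d3 : ∀ z ∈ Icc (min t t') (max t t'), 0 ≤ -(β * deriv (deriv f) z) - κ / 2 :=
    fun z hz => by linarith [(hb m z hm (hIcc z hz)).1]
  have k1 := tangent_le_of_deriv2_nonneg d1 d2 d3 huI htI
  have k2 := tangent_le_of_deriv2_nonneg d1 d2 d3 huI htI'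
  -- The level at the midpoint parameter exceeds `Y - s` by at least `κ * (t - t') ^ 2 / 16`, yet is
  -- at most `Y`.
  have hquad : κ * (t - t') ^ 2 ≤ 16 * s := by
    have e1 : t' - u = -(t - u) := by rw [hu]; ring
    rw [e1] at k2
    have h1 : 2 * ψ u ≤ ψ t + ψ t' := by linarith
    simp only [hψ] at h1
    have h2 : u ^ 2 = (t ^ 2 + t' ^ 2) / 2 - (t - t') ^ 2 / 4 := by rw [hu]; ring
    have h3 : 2 * u = t + t' := by rw [hu]; ring
    rw [h2] at h1
    rw [hβ] at h1
    linear_combination 8 * h1 + 16 * hmid - 8 * hvs - 8 * hvs' + 8 * (m * e E₀ 0 - e E₀ 1) * h3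
  have hlip : |f t - f t'| ≤ |t - t'| := by
    have := (convex_Icc (min t t') (max t t')).norm_image_sub_le_of_norm_hasDerivWithin_le
      (f := f) (f' := deriv f) (C := 1) (fun z _ => (D1 z).hasDerivWithinAt)
      (fun z hz => (hb m z hm (hIcc z hz)).2.1.le) htI' htI
    simpa using this
  -- Passing from the parameter to the first coordinate costs a factor `2`, which turns `16` into
  -- `64` after squaring.
  have hdiff : |P 0 + (t * e E₀ 0 + f t * e E₁ 0) - (P 0 + (t' * e E₀ 0 + f t' * e E₁ 0))| ≤
      2 * |t - t'| := by
    rw [show P 0 + (t * e E₀ 0 + f t * e E₁ 0) - (P 0 + (t' * e E₀ 0 + f t' * e E₁ 0)) =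
      (t - t') * e E₀ 0 + (f t - f t') * e E₁ 0 by ring]
    refine (abs_add_le _ _).trans ?_
    rw [abs_mul, abs_mul]
    have h1 := mul_le_mul_of_nonneg_left (hA 0) (abs_nonneg (t - t'))
    have h2 := mul_le_mul hlip (hB 0) (abs_nonneg _) (abs_nonneg _)
    linarith
  have hsq := pow_le_pow_left₀ (abs_nonneg _) hdiff 2
  rw [sq_abs, mul_pow, sq_abs] at hsq
  have := mul_le_mul_of_nonneg_left hsq hκ.le
  linarith

/-- On the graph of `|x| ^ γ` one can always climb by increasing `|x|`, so a highest point is not on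
that piece and the curvature hypothesis applies to it. -/
theorem IsFlatBody.highest_not_mem_half {γ : ℝ} {C U : Set Plane} (hγ : 2 < γ) (hC : IsClosed C)
    (hU : IsOpen U) (hhalf : (1 / 2 : ℝ) • U ⊆ U)
    (hfr : frontier C ∩ U = {x : Plane | x 1 = |x 0| ^ γ} ∩ U) {P : Plane} (hP : P ∈ frontier C)
    (hmax : ∀ v ∈ C, v 1 ≤ P 1) : P ∉ (1 / 2 : ℝ) • U := by
  intro hPU
  have hPU := hhalf hPU
  have hPg : P ∈ {x : Plane | x 1 = |x 0| ^ γ} ∩ U := hfr ▸ ⟨hP, hPU⟩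
  have hP1 : P 1 = |P 0| ^ γ := hPg.1
  obtain ⟨σ, hσ⟩ : ∃ σ : ℝ, ∀ t, 0 < t → |P 0| < |P 0 + t * σ| := by
    rcases le_total 0 (P 0) with h | h
    · refine ⟨1, fun t ht => ?_⟩
      rw [abs_of_nonneg h, abs_of_nonneg] <;> linarith
    · refine ⟨-1, fun t ht => ?_⟩
      rw [abs_of_nonpos h, abs_of_nonpos] <;> linarith
  have hcont : Continuous fun t : ℝ => planePoint (P 0 + t * σ) (|P 0 + t * σ| ^ γ) := by
    have : Continuous fun t : ℝ => |P 0 + t * σ| ^ γ :=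
      (by fun_prop : Continuous fun t : ℝ => |P 0 + t * σ|).rpow_const
        fun x => Or.inr (by linarith)
    fun_prop
  have h0 : planePoint (P 0 + 0 * σ) (|P 0 + 0 * σ| ^ γ) = P := by
    rw [zero_mul, add_zero, ← hP1, planePoint_eta]
  have hn := hcont.continuousAt.preimage_mem_nhds (x := 0) (hU.mem_nhds (h0.symm ▸ hPU))
  obtain ⟨ε, hε, hb⟩ := Metric.mem_nhds_iff.1 hn
  have hmem : planePoint (P 0 + ε / 2 * σ) (|P 0 + ε / 2 * σ| ^ γ) ∈ U := hb (by
    rw [Metric.mem_ball, Real.dist_eq, sub_zero, abs_of_pos] <;> linarith)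
  have hmem2 : planePoint (P 0 + ε / 2 * σ) (|P 0 + ε / 2 * σ| ^ γ) ∈
      {x : Plane | x 1 = |x 0| ^ γ} ∩ U := ⟨rfl, hmem⟩
  rw [← hfr] at hmem2
  have h1 := hmax _ (hC.frontier_subset hmem2.1)
  rw [hP1, planePoint_one] at h1
  exact absurd h1 (not_le.2 (Real.rpow_lt_rpow (abs_nonneg _) (hσ _ (by positivity)) (by linarith)))

theorem IsFlatBody.nonempty {γ : ℝ} {C : Set Plane} (hγ : 2 < γ) (hC : IsFlatBody γ C) :
    C.Nonempty := by
  obtain ⟨r, hr, hg⟩ := hC.exists_graph_mem_frontier hγ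
  exact ⟨_, hC.isCompact.isClosed.frontier_subset (hg 0 (by simpa using hr.le))⟩

/-- For small slopes the upper support region stays near the highest point `P`, where the curvature
estimate bounds the distance between the two ends of a chord. -/
theorem IsFlatBody.exists_top_chord_bound {γ : ℝ} {C : Set Plane} (hγ : 2 < γ)
    (hC : IsFlatBody γ C) :
    ∃ m₀ > 0, ∃ B, 0 ≤ B ∧ ∃ δ > 0, ∀ m, |m| ≤ m₀ → ∀ y₁, (∀ y, (slice C m y).Nonempty → y ≤ y₁) →
      ∀ s ∈ Icc 0 δ, chord C m (y₁ - s) ≤ B * √s := by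
  have hcl := hC.isCompact.isClosed
  obtain ⟨P, hP, hPmax⟩ := hC.isCompact.exists_isMaxOn (hC.nonempty hγ)
    (by fun_prop : Continuous fun v : Plane => v 1).continuousOn
  have hmax : ∀ v ∈ C, v 1 ≤ P 1 := fun v hv => hPmax hv
  have hmaxfr : ∀ v ∈ C, v 1 = P 1 → v ∈ frontier C := fun v hv h =>
    ⟨subset_closure hv, not_mem_interior_of_isMaxOn (m := 0) fun w hw => by
      simpa [h] using hmax w hw⟩
  have hPfr := hmaxfr P hP rfl
  obtain ⟨U, hU, -, hhalf, hfr, κ, hκ, hcurv⟩ := hC.boundary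
  have hsm := hcurv P ⟨hPfr, IsFlatBody.highest_not_mem_half hγ hcl hU hhalf hfr hPfr hmax⟩
  obtain ⟨r, hr, m₀, hm₀, key⟩ := hsm.sq_le_of_isMax hcl hκ hmax
  -- A second highest point, moved along the segment towards `P`, would give two nearby boundary
  -- points at depth `s = 0`, which the estimate forces to coincide.
  have huniq : ∀ v ∈ C, v 1 = P 1 → v = P := by
    intro v hv hv1
    have hden : 0 < ‖v - P‖ + r := by positivity
    set t := r / 2 / (‖v - P‖ + r) with ht
    have ht0 : 0 < t := by positivity
    have ht1 : t ≤ 1 := by rw [ht, div_le_one hden]; linarith [norm_nonneg (v - P)]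
    set w := t • v + (1 - t) • P with hw
    have hwC : w ∈ C := hC.convex hv hP ht0.le (sub_nonneg.2 ht1) (by ring)
    have hw1 : w 1 = P 1 := by simp [hw, hv1]; ring
    have hwP : w - P = t • (v - P) := by rw [hw]; module
    have hwr : ‖w - P‖ < r := by
      rw [hwP, norm_smul, Real.norm_eq_abs, abs_of_pos ht0, ht, div_mul_eq_mul_div,
        div_lt_iff₀ hden]
      nlinarith [norm_nonneg (v - P)]
    have := key 0 (by simpa using hm₀.le) (P 1) (fun w hw => by simpa using hmax w hw) w
      (hmaxfr w hwC hw1) P hPfr hwr (by simpa using hr) 0 (by simp [hw1]) (by simp)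
    have hz : (w 0 - P 0) ^ 2 = 0 := by
      have h1 : 0 ≤ (w 0 - P 0) ^ 2 := sq_nonneg _
      nlinarith
    have hz' : w 0 = P 0 := by linarith [pow_eq_zero_iff (two_ne_zero) |>.1 hz]
    have hwP' : t • (v - P) = 0 := by rw [← hwP, plane_ext hz' hw1, sub_self]
    rcases smul_eq_zero.1 hwP' with h | h
    · exact absurd h ht0.ne'
    · exact sub_eq_zero.1 h
  -- By compactness, points of `C` of almost maximal height are close to `P`.
  obtain ⟨τ, hτ, hnear⟩ : ∃ τ > 0, ∀ v ∈ C, P 1 - τ ≤ v 1 → ‖v - P‖ < r := by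
    set K := C ∩ {v : Plane | r ≤ ‖v - P‖} with hK
    have hKc : IsCompact K := hC.isCompact.inter_right (isClosed_le continuous_const (by fun_prop))
    rcases K.eq_empty_or_nonempty with h | h
    · refine ⟨1, one_pos, fun v hv _ => ?_⟩
      by_contra! hlt
      have : v ∈ K := ⟨hv, hlt⟩
      rw [h] at this; exact this
    · obtain ⟨Q, hQ, hQmax⟩ := hKc.exists_isMaxOn h
        (by fun_prop : Continuous fun v : Plane => v 1).continuousOn
      have hlt : Q 1 < P 1 := lt_of_le_of_ne (hmax Q hQ.1) fun h => by
        have := hQ.2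
        rw [huniq Q hQ.1 h] at this
        simp at this; linarith
      refine ⟨(P 1 - Q 1) / 2, by linarith, fun v hv hv1 => ?_⟩
      by_contra! hge
      have : v 1 ≤ Q 1 := hQmax (⟨hv, hge⟩ : v ∈ K)
      linarith
  refine ⟨min m₀ (τ / 2), by positivity, 8 / √κ, by positivity, τ / 2, by positivity, ?_⟩
  intro m hm y₁ hy₁ s hs
  have hsq : 0 < √κ := Real.sqrt_pos.2 hκ
  have hY : ∀ w ∈ C, w 1 - m * w 0 ≤ y₁ := fun w hw => hy₁ _ ⟨_, mem_slice_self m hw⟩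
  by_cases hne : (slice C m (y₁ - s)).Nonempty
  · obtain ⟨l, q, hlq, hI, hch⟩ := exists_slice_eq_Icc hC.isCompact hC.convex hne
    have hclose : ∀ x ∈ slice C m (y₁ - s), ‖planePoint x (y₁ - s + m * x) - P‖ < r := by
      intro x hx
      apply hnear _ hx
      have h1 := hY P hP
      have h2 := hC.subset_square P hP 0
      have h3 := hC.subset_square _ hx 0
      rw [planePoint_zero] at h3
      -- `C` lies in the unit square, so tilting costs at most `τ / 2` in height; the depth `s`
      -- costs the other half of `τ`.
      have h4 : |m * (P 0 - x)| ≤ τ / 2 * 1 := by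
        rw [abs_mul]
        apply mul_le_mul (hm.trans (min_le_right _ _)) _ (abs_nonneg _) (by positivity)
        exact abs_le.2 ⟨by linarith [h2.1, h3.2], by linarith [h2.2, h3.1]⟩
      have h5 := (abs_le.1 h4).2
      rw [planePoint_one]
      linarith [hs.2]
    have := key m (hm.trans (min_le_left _ _)) y₁ hY _
      (planePoint_mem_frontier hI hlq (Or.inr rfl)) _
      (planePoint_mem_frontier hI hlq (Or.inl rfl))
      (hclose q (hI ▸ right_mem_Icc.2 hlq)) (hclose l (hI ▸ left_mem_Icc.2 hlq)) s
      (by simp) (by simp)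
    rw [planePoint_zero, planePoint_zero] at this
    rw [hch, div_mul_eq_mul_div, le_div_iff₀ hsq]
    refine (abs_le_of_sq_le_sq' ?_ (by positivity)).2
    rw [mul_pow, mul_pow, Real.sq_sqrt hκ.le, Real.sq_sqrt hs.1]
    linarith
  · rw [chord_eq_zero_of_empty hne]; positivity

/-! ### Cosine integrals over the body for an interval of slopes -/

theorem IsFlatBody.exists_integral_cos_le {γ : ℝ} {C : Set Plane} (hγ : 2 < γ)
    (hC : IsFlatBody γ C) :
    ∃ m₁ m₂, m₁ < m₂ ∧ ∃ h₀ > 0, ∀ m ∈ Icc m₁ m₂, ∃ y₀, ∀ h, 0 < h → h ≤ h₀ →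
      ∫ v in C, Real.cos (Real.pi / h * (v 1 - m * v 0 - y₀)) ≤ -(√h * h) := by
  obtain ⟨r, hr, hg⟩ := hC.exists_graph_mem_frontier hγ
  obtain ⟨m₀, hm₀, B, hB, δ₁, hδ₁, htop⟩ := hC.exists_top_chord_bound hγ
  obtain ⟨m₁, m₂, hm₁, hm₁₂, hm₂, c, hcM, hc, δ₂, hδ₂, hbot⟩ :=
    -- The top constants `B` and `m₀` are fixed before the flat contact point is chosen; `c ≥ 400 *
    -- (4 * B + 1)` makes `4 * B - c / 400 ≤ -1`.
    exists_bottom_chord_bounds hγ hC.isCompact hC.convex hr hg (400 * (4 * B + 1)) hm₀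
  set δ := min δ₁ δ₂ with hδ
  have hδ0 : 0 < δ := lt_min hδ₁ hδ₂
  refine ⟨m₁, m₂, hm₁₂, δ / 2, by positivity, fun m hm => ?_⟩
  obtain ⟨y₀, hy₀, hch⟩ := hbot m hm
  obtain ⟨z₀, y₁, -, hlev⟩ := exists_levels_eq_Icc hC.isCompact hC.convex (hC.nonempty hγ) m
  have hz₀ : z₀ = y₀ := by
    have h1 := (hlev _).1 (hch 0 ⟨le_rfl, hδ₂.le⟩).1
    rw [add_zero] at h1
    exact le_antisymm h1.1 (hy₀ _ ((hlev z₀).2 ⟨le_rfl, h1.1.trans h1.2⟩))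
  subst hz₀
  refine ⟨z₀, fun h hh hhδ => ?_⟩
  set a : ℝ → ℝ := fun s => chord C m (z₀ + s) with ha
  set L := y₁ - z₀ with hL
  have hδL : δ ≤ L := by
    have := ((hlev _).1 (hch δ ⟨hδ0.le, min_le_right _ _⟩).1).2
    rw [hL]; linarith
  have hconc : ConcaveOn ℝ (Icc 0 L) a := by
    have := (concaveOn_chord hC.isCompact hC.convex (fun y hy => (hlev y).2 hy)).translate_right z₀
    refine this.subset (fun s hs => ?_) (convex_Icc _ _)
    exact ⟨by linarith [hs.1], by linarith [hs.2]⟩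
  have hint : Integrable a := (integrable_chord hC.isCompact m).comp_add_left z₀
  have key := hconc.integral_cos_le hh hc (by linarith : 2 * h ≤ δ) hδL hB
    hint.intervalIntegrable (fun s hs => (hch s ⟨hs.1, hs.2.trans (min_le_right _ _)⟩).2.1)
    (fun s hs => (hch s ⟨hs.1, hs.2.trans (min_le_right _ _)⟩).2.2)
    (fun s hs => by
      have := htop m (abs_le.2 ⟨by linarith [hm.1], hm.2.trans hm₂⟩) y₁
        (fun y hy => ((hlev y).1 hy).2) s ⟨hs.1, hs.2.trans (min_le_left _ _)⟩
      rw [ha, abs_of_nonneg (chord_nonneg _ _ _), hL]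
      convert this using 2; ring)
  have e1 : ∫ v in C, Real.cos (Real.pi / h * (v 1 - m * v 0 - z₀)) =
      ∫ s in (0 : ℝ)..L, a s * Real.cos (Real.pi / h * s) := by
    rw [setIntegral_linear_eq_integral_chord hC.isCompact m
      (g := fun y => Real.cos (Real.pi / h * (y - z₀))) (by fun_prop),
      ← integral_add_left_eq_self _ z₀, intervalIntegral.integral_of_le (by linarith),
      ← integral_Icc_eq_integral_Ioc]
    simp only [add_sub_cancel_left]
    refine (setIntegral_eq_integral_of_forall_compl_eq_zero fun s hs => ?_).symm
    have : ¬ (slice C m (z₀ + s)).Nonempty := fun hne => hs (by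
      have := (hlev _).1 hne
      exact ⟨by linarith [this.1], by linarith [this.2]⟩)
    rw [chord_eq_zero_of_empty this, zero_mul]
  rw [e1]
  refine key.trans ?_
  have : 0 < √h * h := by positivity
  nlinarith

/-! ### Rotations and the torus -/

/-- Rotation by `θ` as a linear isometry. -/
noncomputable def rotIsometry (θ : ℝ) : Plane ≃ₗᵢ[ℝ] Plane where
  toFun := rot θ
  invFun := rot (-θ)
  map_add' v w := by apply plane_ext <;> simp [rot] <;> ring
  map_smul' c v := by apply plane_ext <;> simp [rot] <;> ring
  left_inv v := by
    apply plane_ext <;> simp [rot]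
    · linear_combination v 0 * Real.cos_sq_add_sin_sq θ
    · linear_combination v 1 * Real.cos_sq_add_sin_sq θ
  right_inv v := by
    apply plane_ext <;> simp [rot]
    · linear_combination v 0 * Real.cos_sq_add_sin_sq θ
    · linear_combination v 1 * Real.cos_sq_add_sin_sq θ
  norm_map' v := by
    change ‖rot θ v‖ = ‖v‖
    rw [EuclideanSpace.norm_eq, EuclideanSpace.norm_eq]
    congr 1
    simp [rot]
    linear_combination (v 0 ^ 2 + v 1 ^ 2) * Real.cos_sq_add_sin_sq θ


theorem rot_rot_neg (θ : ℝ) (v : Plane) : rot θ (rot (-θ) v) = v :=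
  (rotIsometry θ).apply_symm_apply v

theorem rot_neg_rot (θ : ℝ) (v : Plane) : rot (-θ) (rot θ v) = v :=
  (rotIsometry θ).symm_apply_apply v

theorem measurePreserving_rot (θ : ℝ) : MeasurePreserving (rot θ) :=
  (rotIsometry θ).measurePreserving

theorem mem_rot_image {C : Set Plane} {θ : ℝ} {v : Plane} : v ∈ rot θ '' C ↔ rot (-θ) v ∈ C := by
  constructor
  · rintro ⟨w, hw, rfl⟩; rwa [rot_neg_rot]
  · intro h; exact ⟨_, h, rot_rot_neg θ v⟩

theorem volume_real_rot_image (C : Set Plane) (θ : ℝ) :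
    volume.real (rot θ '' C) = volume.real C := by
  have h : rot θ '' C = (rotIsometry (-θ)) ⁻¹' C := by
    ext v; rw [mem_rot_image]; rfl
  rw [h, measureReal_def, measureReal_def]
  congr 1
  exact (rotIsometry (-θ)).measurePreserving.measure_preimage_equiv
    (f := (rotIsometry (-θ)).toMeasurableEquiv) C

theorem measurableSet_torusSquare : MeasurableSet torusSquare := by
  have : torusSquare = ⋂ i : Fin 2, (fun t : Plane => t i) ⁻¹' Ico (-(1 / 2)) (1 / 2) := by
    ext t; simp [torusSquare]
  rw [this]
  exact MeasurableSet.iInter fun i =>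
    (by fun_prop : Continuous fun t : Plane => t i).measurable measurableSet_Ico

theorem planePoint_preimage_torusSquare :
    (fun p : ℝ × ℝ => planePoint p.1 p.2) ⁻¹' torusSquare =
      Ico (-(1 / 2)) (1 / 2) ×ˢ Ico (-(1 / 2)) (1 / 2) := by
  ext p
  simp [torusSquare, Fin.forall_fin_two]

theorem volume_torusSquare : volume torusSquare = 1 := by
  rw [← measurePreserving_planePoint.measure_preimage measurableSet_torusSquare.nullMeasurableSet,
    planePoint_preimage_torusSquare, Measure.volume_eq_prod, Measure.prod_prod, Real.volume_Ico]
  norm_num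

instance : IsProbabilityMeasure (volume.restrict torusSquare) :=
  ⟨by rw [Measure.restrict_apply_univ, volume_torusSquare]⟩

theorem integral_torusSquare_cos {K : ℤ} (hK : K ≠ 0) (α : ℝ) :
    ∫ t in torusSquare, Real.cos (2 * Real.pi * K * t 0 + α) = 0 := by
  rw [← measurePreserving_planePoint.map_eq, setIntegral_map measurableSet_torusSquare
    (by fun_prop) measurePreserving_planePoint.aemeasurable, planePoint_preimage_torusSquare]
  have := setIntegral_prod_mul (μ := (volume : Measure ℝ)) (ν := (volume : Measure ℝ))
    (fun x => Real.cos (2 * Real.pi * K * x + α)) (fun _ => (1 : ℝ))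
    (Ico (-(1 / 2)) (1 / 2)) (Ico (-(1 / 2)) (1 / 2))
  simp only [mul_one] at this
  simp only [planePoint_zero]
  rw [Measure.volume_eq_prod, this, integral_Ico_eq_integral_Ioc,
    ← intervalIntegral.integral_of_le (by norm_num),
    intervalIntegral.integral_comp_mul_add (f := Real.cos) (c := 2 * Real.pi * K)
      (by have := Real.pi_ne_zero; have : (K : ℝ) ≠ 0 := by exact_mod_cast hK
          positivity) α, integral_cos]
  have : 2 * Real.pi * K * (1 / 2) + α = (2 * Real.pi * K * -(1 / 2) + α) + K * (2 * Real.pi) := by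
    ring
  rw [this, Real.sin_add_int_mul_two_pi]
  simp

/-! ### The lattice point count and its Fourier coefficients -/

/-- The integer points with both coordinates of absolute value at most `N`. -/
noncomputable def latticeBox (N : ℕ) : Finset (ℤ × ℤ) :=
  Finset.Icc (-N : ℤ) N ×ˢ Finset.Icc (-N : ℤ) N

theorem mem_latticeBox {N : ℕ} {n : ℤ × ℤ} (h0 : |(n.1 : ℝ)| ≤ N) (h1 : |(n.2 : ℝ)| ≤ N) :
    n ∈ latticeBox N := by
  rw [abs_le] at h0 h1
  simp only [latticeBox, Finset.mem_product, Finset.mem_Icc]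
  exact ⟨⟨by exact_mod_cast h0.1, by exact_mod_cast h0.2⟩,
    ⟨by exact_mod_cast h1.1, by exact_mod_cast h1.2⟩⟩

/-- The number of points of the box of size `N` in the body `R σ(C) + t`, where `σ` is the rotation
by `θ`. -/
noncomputable def boxCount (C : Set Plane) (N : ℕ) (R θ : ℝ) (t : Plane) : ℝ :=
  ∑ n ∈ latticeBox N, C.indicator (fun _ => (1 : ℝ)) (rot (-θ) (R⁻¹ • (planePoint n.1 n.2 - t)))

section Count

variable {C : Set Plane} {N : ℕ} {R θ : ℝ}

theorem abs_rot_apply_le {v : Plane} (hv : ∀ i, -(1 / 2 : ℝ) < v i ∧ v i < 1 / 2) (θ : ℝ)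
    (i : Fin 2) : |rot θ v i| ≤ 1 := by
  have h : ∀ i, |v i| ≤ 1 / 2 := fun i => abs_le.2 ⟨(hv i).1.le, (hv i).2.le⟩
  have hc := Real.abs_cos_le_one θ
  have hs := Real.abs_sin_le_one θ
  have key : ∀ a b x y : ℝ, |a| ≤ 1 → |b| ≤ 1 → |x| ≤ 1 / 2 → |y| ≤ 1 / 2 →
      |a * x + b * y| ≤ 1 := fun a b x y ha hb hx hy => by
    refine (abs_add_le _ _).trans ?_
    rw [abs_mul, abs_mul]
    have h1 := mul_le_mul ha hx (abs_nonneg _) zero_le_one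
    have h2 := mul_le_mul hb hy (abs_nonneg _) zero_le_one
    linarith
  fin_cases i
  · have := key (Real.cos θ) (-Real.sin θ) (v 0) (v 1) hc (by rwa [abs_neg]) (h 0) (h 1)
    simpa [rot, sub_eq_add_neg] using this
  · simpa [rot] using key (Real.sin θ) (Real.cos θ) (v 0) (v 1) hs hc (h 0) (h 1)

theorem abs_apply_le_of_rot_mem (hsq : ∀ x ∈ C, ∀ i, -(1 / 2 : ℝ) < x i ∧ x i < 1 / 2)
    (hR : 0 < R) {x : Plane} (hx : rot (-θ) (R⁻¹ • x) ∈ C) (i : Fin 2) : |x i| ≤ R := by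
  have := abs_rot_apply_le (hsq _ hx) θ i
  rw [rot_rot_neg, PiLp.smul_apply, smul_eq_mul, abs_mul, abs_inv, abs_of_pos hR,
    inv_mul_le_iff₀ hR, mul_one] at this
  exact this

/-- Points of `R σ(C)` have coordinates at most `R` in absolute value and `t` adds at most `1 / 2`,
so the box misses nothing. The finite sum makes measurability and boundedness in `(θ, t)` immediate.
-/
theorem ncard_eq_boxCount (hsq : ∀ x ∈ C, ∀ i, -(1 / 2 : ℝ) < x i ∧ x i < 1 / 2)
    (hR : 0 < R) (hN : R + 1 ≤ N) {t : Plane} (ht : t ∈ torusSquare) :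
    ((((fun x : Plane => R • x + t) '' (rot θ '' C)) ∩ integerPoints).ncard : ℝ) =
      boxCount C N R θ t := by
  classical
  have hset : ((fun x : Plane => R • x + t) '' (rot θ '' C)) ∩ integerPoints =
      (fun n : ℤ × ℤ => planePoint n.1 n.2) '' ((latticeBox N).filter
        fun n => rot (-θ) (R⁻¹ • (planePoint n.1 n.2 - t)) ∈ C : Finset (ℤ × ℤ)) := by
    ext v
    simp only [mem_inter_iff, mem_image, Finset.coe_filter]
    constructor
    · rintro ⟨⟨_, ⟨w, hw, rfl⟩, rfl⟩, hint⟩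
      obtain ⟨a, ha⟩ := hint 0
      obtain ⟨b, hb⟩ := hint 1
      have hv : planePoint (a : ℝ) b = R • rot θ w + t := plane_ext ha.symm hb.symm
      have hmem : rot (-θ) (R⁻¹ • (planePoint (a : ℝ) b - t)) ∈ C := by
        rw [hv, add_sub_cancel_right, smul_smul, inv_mul_cancel₀ hR.ne', one_smul, rot_neg_rot]
        exact hw
      refine ⟨(a, b), ⟨?_, hmem⟩, hv⟩
      have h0 := abs_le.1 (abs_apply_le_of_rot_mem hsq hR hmem 0)
      have h1 := abs_le.1 (abs_apply_le_of_rot_mem hsq hR hmem 1)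
      simp only [PiLp.sub_apply, planePoint_zero, planePoint_one] at h0 h1
      have t0 := ht 0
      have t1 := ht 1
      exact mem_latticeBox (abs_le.2 ⟨by linarith, by linarith⟩)
        (abs_le.2 ⟨by linarith, by linarith⟩)
    · rintro ⟨n, ⟨-, hn⟩, rfl⟩
      refine ⟨⟨_, ⟨_, hn, rfl⟩, ?_⟩, ?_⟩
      · rw [rot_rot_neg, smul_smul, mul_inv_cancel₀ hR.ne', one_smul, sub_add_cancel]
      · intro i; fin_cases i
        · exact ⟨n.1, rfl⟩
        · exact ⟨n.2, rfl⟩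
  have hinj : Function.Injective fun n : ℤ × ℤ => planePoint n.1 n.2 := by
    intro n n' h
    have h0 : (n.1 : ℝ) = n'.1 := congrArg (fun v : Plane => v 0) h
    have h1 : (n.2 : ℝ) = n'.2 := congrArg (fun v : Plane => v 1) h
    exact Prod.ext (by exact_mod_cast h0) (by exact_mod_cast h1)
  rw [hset, ncard_image_of_injective _ hinj, ncard_coe_finset, Finset.card_filter, boxCount]
  push_cast
  refine Finset.sum_congr rfl fun n _ => ?_
  simp [indicator]

theorem discrepancy_eq_boxCount (hsq : ∀ x ∈ C, ∀ i, -(1 / 2 : ℝ) < x i ∧ x i < 1 / 2)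
    (hR : 0 < R) (hN : R + 1 ≤ N) {t : Plane} (ht : t ∈ torusSquare) :
    discrepancy (rot θ '' C) R t = -R ^ 2 * volume.real C + boxCount C N R θ t := by
  rw [discrepancy, volume_real_rot_image, ncard_eq_boxCount hsq hR hN ht]

theorem measurable_boxCount (hC : IsClosed C) (N : ℕ) (R : ℝ) :
    Measurable fun q : ℝ × Plane => boxCount C N R q.1 q.2 := by
  unfold boxCount
  refine Finset.measurable_sum _ fun n _ => ?_
  have hc : Continuous fun q : ℝ × Plane => rot (-q.1) (R⁻¹ • (planePoint n.1 n.2 - q.2)) := by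
    have h0 : Continuous fun q : ℝ × Plane => R⁻¹ • (planePoint n.1 n.2 - q.2) := by fun_prop
    have h1 : ∀ i, Continuous fun q : ℝ × Plane => (R⁻¹ • (planePoint n.1 n.2 - q.2)) i :=
      fun i => by fun_prop
    have hcos : Continuous fun q : ℝ × Plane => Real.cos (-q.1) := by fun_prop
    have hsin : Continuous fun q : ℝ × Plane => Real.sin (-q.1) := by fun_prop
    exact Continuous.planePoint ((hcos.mul (h1 0)).sub (hsin.mul (h1 1)))
      ((hsin.mul (h1 0)).add (hcos.mul (h1 1)))
  exact (measurable_const.indicator hC.measurableSet).comp hc.measurable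

theorem measurable_boxCount_right (hC : IsClosed C) (N : ℕ) (R θ : ℝ) :
    Measurable (boxCount C N R θ) := by
  have hp : Measurable fun t : Plane => (θ, t) := measurable_prodMk_left
  have h := (measurable_boxCount hC N R).comp hp
  exact h

theorem boxCount_nonneg (C : Set Plane) (N : ℕ) (R θ : ℝ) (t : Plane) : 0 ≤ boxCount C N R θ t :=
  Finset.sum_nonneg fun _ _ => indicator_nonneg (fun _ _ => zero_le_one) _

theorem boxCount_le (C : Set Plane) (N : ℕ) (R θ : ℝ) (t : Plane) :
    boxCount C N R θ t ≤ (latticeBox N).card := by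
  unfold boxCount
  refine (Finset.sum_le_card_nsmul _ _ 1 fun n _ => ?_).trans (by simp)
  exact indicator_le_self' (fun _ _ => zero_le_one) _

theorem integrable_boxCount_mul_cos (hC : IsClosed C) (N : ℕ) (R θ b α : ℝ) :
    IntegrableOn (fun t => boxCount C N R θ t * Real.cos (b * t 0 + α)) torusSquare := by
  have hm := measurable_boxCount_right hC N R θ
  have hcos : Measurable fun t : Plane => Real.cos (b * t 0 + α) :=
    (by fun_prop : Continuous fun t : Plane => Real.cos (b * t 0 + α)).measurable
  refine Integrable.of_bound (hm.mul hcos).aestronglyMeasurable ((latticeBox N).card : ℝ)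
    (.of_forall fun t => ?_)
  rw [norm_mul, Real.norm_eq_abs, Real.norm_eq_abs, abs_of_nonneg (boxCount_nonneg _ _ _ _ _)]
  exact (mul_le_of_le_one_right (boxCount_nonneg _ _ _ _ _) (Real.abs_cos_le_one _)).trans
    (boxCount_le _ _ _ _ _)

theorem existsUnique_int_sub_mem (a : ℝ) :
    -(1 / 2) ≤ (⌈a - 1 / 2⌉ : ℝ) - a ∧ (⌈a - 1 / 2⌉ : ℝ) - a < 1 / 2 ∧
      ∀ n : ℤ, -(1 / 2) ≤ (n : ℝ) - a → (n : ℝ) - a < 1 / 2 → n = ⌈a - 1 / 2⌉ := by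
  have h1 := Int.le_ceil (a - 1 / 2)
  have h2 := Int.ceil_lt_add_one (a - 1 / 2)
  refine ⟨by linarith, by linarith, fun n hn hn' => ?_⟩
  symm
  rw [Int.ceil_eq_iff]
  constructor <;> linarith

/-- The Fourier coefficients of the counting function, by unfolding the torus. -/
theorem integral_boxCount_mul_cos (hC : IsCompact C)
    (hsq : ∀ x ∈ C, ∀ i, -(1 / 2 : ℝ) < x i ∧ x i < 1 / 2)
    (hR : 0 < R) (hN : R + 1 ≤ N) (K : ℤ) (θ α : ℝ) :
    ∫ t in torusSquare, boxCount C N R θ t * Real.cos (2 * Real.pi * K * t 0 + α) =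
      R ^ 2 * ∫ v in C, Real.cos (2 * Real.pi * K * R * rot θ v 0 - α) := by
  set G : Plane → ℝ := fun x => C.indicator (fun _ => (1 : ℝ)) (rot (-θ) (R⁻¹ • x)) *
    Real.cos (2 * Real.pi * K * x 0 - α) with hG
  have hscale : ∫ x, G x = R ^ 2 * ∫ v in C, Real.cos (2 * Real.pi * K * R * rot θ v 0 - α) := by
    set F : Plane → ℝ := fun x => C.indicator (fun _ => (1 : ℝ)) (rot (-θ) x) *
      Real.cos (2 * Real.pi * K * R * x 0 - α) with hF
    have h1 : ∀ x, G x = F (R⁻¹ • x) := fun x => by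
      simp only [hG, hF, PiLp.smul_apply, smul_eq_mul]
      congr 2
      field_simp
    simp_rw [h1]
    rw [Measure.integral_comp_inv_smul]
    simp only [finrank_euclideanSpace, Fintype.card_fin, smul_eq_mul]
    rw [abs_of_pos (by positivity)]
    congr 1
    rw [← (measurePreserving_rot θ).integral_comp
      (rotIsometry θ).toMeasurableEquiv.measurableEmbedding, ← integral_indicator
      hC.isClosed.measurableSet]
    refine integral_congr_ae (.of_forall fun v => ?_)
    simp only [hF, rot_neg_rot]
    by_cases hv : v ∈ C <;> simp [hv]
  have hterm : ∀ n : ℤ × ℤ, ∀ t : Plane, G (planePoint n.1 n.2 - t) =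
      C.indicator (fun _ => (1 : ℝ)) (rot (-θ) (R⁻¹ • (planePoint n.1 n.2 - t))) *
        Real.cos (2 * Real.pi * K * t 0 + α) := fun n t => by
    simp only [hG, PiLp.sub_apply, planePoint_zero]
    congr 1
    rw [show 2 * Real.pi * K * (n.1 - t 0) - α =
      -(2 * Real.pi * K * t 0 + α) + ((K * n.1 : ℤ) : ℝ) * (2 * Real.pi) by push_cast; ring,
      Real.cos_add_int_mul_two_pi, Real.cos_neg]
  have hGi : Integrable G := by
    have hc : Continuous fun x : Plane => rot (-θ) (R⁻¹ • x) :=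
      Continuous.planePoint (by fun_prop) (by fun_prop)
    set A : Set Plane := (fun x : Plane => rot (-θ) (R⁻¹ • x)) ⁻¹' C with hA
    have hAc : IsCompact A := by
      have : A = (fun x : Plane => R • rot θ x) '' C := by
        ext x; constructor
        · intro hx
          refine ⟨_, hx, ?_⟩
          simp only [rot_rot_neg, smul_smul, mul_inv_cancel₀ hR.ne', one_smul]
        · rintro ⟨v, hv, rfl⟩
          simpa [hA, smul_smul, inv_mul_cancel₀ hR.ne', rot_neg_rot] using hv
      rw [this]
      have : Continuous fun x : Plane => rot θ x := (rotIsometry θ).continuous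
      exact hC.image (by fun_prop)
    have : G = A.indicator fun x => Real.cos (2 * Real.pi * K * x 0 - α) := by
      funext x
      by_cases hx : rot (-θ) (R⁻¹ • x) ∈ C
      · have : x ∈ A := hx
        simp [hG, hx, this]
      · have : x ∉ A := hx
        simp [hG, hx, this]
    rw [this]
    apply IntegrableOn.integrable_indicator _ hAc.isClosed.measurableSet
    exact ContinuousOn.integrableOn_compact hAc (by fun_prop)
  -- The translates of the half-open square tile the plane: exactly one integer point `n` has `n -
  -- x` in it, and it lies in the box when `G x` can be nonzero.
  have htile : ∀ x, G x = ∑ n ∈ latticeBox N,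
      torusSquare.indicator (fun t => G (planePoint n.1 n.2 - t)) (planePoint n.1 n.2 - x) := by
    intro x
    by_cases hx : rot (-θ) (R⁻¹ • x) ∈ C
    · obtain ⟨a1, a2, a3⟩ := existsUnique_int_sub_mem (x 0)
      obtain ⟨b1, b2, b3⟩ := existsUnique_int_sub_mem (x 1)
      have h0 := abs_le.1 (abs_apply_le_of_rot_mem hsq hR hx 0)
      have h1 := abs_le.1 (abs_apply_le_of_rot_mem hsq hR hx 1)
      rw [Finset.sum_eq_single ((⌈x 0 - 1 / 2⌉, ⌈x 1 - 1 / 2⌉) : ℤ × ℤ)]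
      · rw [indicator_of_mem, sub_sub_cancel]
        intro i; fin_cases i
        · exact ⟨a1, a2⟩
        · exact ⟨b1, b2⟩
      · intro n _ hn
        rw [indicator_of_notMem]
        intro hmem
        exact hn (Prod.ext (a3 n.1 (hmem 0).1 (hmem 0).2) (b3 n.2 (hmem 1).1 (hmem 1).2))
      · intro hn
        exact absurd (mem_latticeBox (abs_le.2 ⟨by linarith, by linarith⟩)
          (abs_le.2 ⟨by linarith, by linarith⟩)) hn
    · have hG0 : G x = 0 := by simp [hG, hx]
      rw [hG0]
      symm
      refine Finset.sum_eq_zero fun n _ => ?_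
      by_cases hn : planePoint n.1 n.2 - x ∈ torusSquare
      · rw [indicator_of_mem hn, sub_sub_cancel, hG0]
      · rw [indicator_of_notMem hn]
  have hI : ∀ n : ℤ × ℤ, Integrable
      (torusSquare.indicator fun t => G (planePoint n.1 n.2 - t)) := fun n =>
    (hGi.comp_sub_left _).indicator measurableSet_torusSquare
  calc ∫ t in torusSquare, boxCount C N R θ t * Real.cos (2 * Real.pi * K * t 0 + α)
      = ∫ t in torusSquare, ∑ n ∈ latticeBox N, G (planePoint n.1 n.2 - t) := by
        simp_rw [hterm, ← Finset.sum_mul]; rfl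
    _ = ∑ n ∈ latticeBox N, ∫ t in torusSquare, G (planePoint n.1 n.2 - t) :=
        integral_finsetSum _ fun n _ => (hGi.comp_sub_left _).integrableOn
    _ = ∑ n ∈ latticeBox N, ∫ x, torusSquare.indicator (fun t => G (planePoint n.1 n.2 - t))
          (planePoint n.1 n.2 - x) := by
        refine Finset.sum_congr rfl fun n _ => ?_
        rw [integral_sub_left_eq_self (torusSquare.indicator fun t => G (planePoint n.1 n.2 - t))
          volume (planePoint n.1 n.2), integral_indicator measurableSet_torusSquare]
    _ = ∫ x, G x := by
        rw [← integral_finsetSum _ fun n _ => (hI n).comp_sub_left _]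
        exact integral_congr_ae (.of_forall fun x => (htile x).symm)
    _ = _ := hscale

end Count

/-! ### From a Fourier coefficient to an `L^p` norm -/

section Norms

variable {C : Set Plane} {N : ℕ} {R θ p V : ℝ}

theorem measurable_rpow_boxCount (hC : IsClosed C) (N : ℕ) (R V p : ℝ) :
    Measurable fun q : ℝ × Plane => |V + boxCount C N R q.1 q.2| ^ p := by
  have h := ((measurable_boxCount hC N R).const_add V).norm.pow_const p
  exact h

theorem abs_add_boxCount_le (C : Set Plane) (N : ℕ) (R θ V : ℝ) (t : Plane) :
    |V + boxCount C N R θ t| ≤ |V| + (latticeBox N).card := by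
  refine (abs_add_le _ _).trans ?_
  rw [abs_of_nonneg (boxCount_nonneg C N R θ t)]
  exact add_le_add_right (boxCount_le C N R θ t) _

theorem rpow_boxCount_le (hp : 0 ≤ p) (t : Plane) :
    ‖|V + boxCount C N R θ t| ^ p‖ ≤ (|V| + (latticeBox N).card) ^ p := by
  rw [Real.norm_eq_abs, abs_of_nonneg (Real.rpow_nonneg (abs_nonneg _) _)]
  exact Real.rpow_le_rpow (abs_nonneg _) (abs_add_boxCount_le C N R θ V t) hp

theorem integrable_rpow_boxCount (hC : IsClosed C) (hp : 0 ≤ p) :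
    IntegrableOn (fun t => |V + boxCount C N R θ t| ^ p) torusSquare := by
  have hm := ((measurable_boxCount_right hC N R θ).const_add V).norm.pow_const p
  exact Integrable.of_bound hm.aestronglyMeasurable _ (.of_forall fun t => rpow_boxCount_le hp t)

theorem intervalIntegrable_integral_rpow_boxCount (hC : IsClosed C) (hp : 0 ≤ p) (a b : ℝ) :
    IntervalIntegrable (fun θ => ∫ t in torusSquare, |V + boxCount C N R θ t| ^ p) volume a b := by
  have hm : StronglyMeasurable fun θ => ∫ t in torusSquare, |V + boxCount C N R θ t| ^ p :=
    (measurable_rpow_boxCount hC N R V p).stronglyMeasurable.integral_prod_right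
  refine (intervalIntegrable_const (c := (|V| + (latticeBox N).card : ℝ) ^ p)).mono_fun
    hm.aestronglyMeasurable (.of_forall fun θ => ?_)
  refine (norm_integral_le_of_norm_le_const (μ := volume.restrict torusSquare)
    (.of_forall fun t => rpow_boxCount_le hp t)).trans ?_
  simp only [probReal_univ, mul_one]
  exact le_abs_self _

/-- A Fourier coefficient bounds the `L^p` norm of the discrepancy in the translation. -/
theorem rpow_le_integral_boxCount (hC : IsCompact C)
    (hsq : ∀ x ∈ C, ∀ i, -(1 / 2 : ℝ) < x i ∧ x i < 1 / 2) (hR : 0 < R) (hN : R + 1 ≤ N)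
    (hp : 1 ≤ p) {K : ℤ} (hK : K ≠ 0) (α : ℝ) {b : ℝ} (hb : 0 ≤ b)
    (h : ∫ v in C, Real.cos (2 * Real.pi * K * R * rot θ v 0 - α) ≤ -b) :
    (R ^ 2 * b) ^ p ≤ ∫ t in torusSquare, |V + boxCount C N R θ t| ^ p := by
  have hcl := hC.isClosed
  have hp0 : 0 ≤ p := by linarith
  set c : Plane → ℝ := fun t => Real.cos (2 * Real.pi * K * t 0 + α) with hc
  have hi1 := integrable_boxCount_mul_cos hcl N R θ (2 * Real.pi * K) α
  have hi0 : IntegrableOn (fun t => V * c t) torusSquare := by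
    have hcm : Measurable c :=
      (by fun_prop : Continuous fun t : Plane => Real.cos (2 * Real.pi * K * t 0 + α)).measurable
    refine Integrable.of_bound (hcm.const_mul V).aestronglyMeasurable |V| (.of_forall fun t => ?_)
    rw [norm_mul, Real.norm_eq_abs, Real.norm_eq_abs]
    exact mul_le_of_le_one_right (abs_nonneg _) (Real.abs_cos_le_one _)
  -- The constant `V`, which stands for the area term, disappears because the frequency is nonzero.
  have hcoef : ∫ t in torusSquare, (V + boxCount C N R θ t) * c t ≤ -(R ^ 2 * b) := by
    simp_rw [add_mul]
    rw [integral_add hi0 hi1, integral_const_mul, integral_torusSquare_cos hK,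
      integral_boxCount_mul_cos hC hsq hR hN]
    have := mul_le_mul_of_nonneg_left h (sq_nonneg R)
    linarith
  have hi2 : IntegrableOn (fun t => |V + boxCount C N R θ t|) torusSquare := by
    simpa using integrable_rpow_boxCount (V := V) (N := N) (R := R) (θ := θ) hcl zero_le_one
  have hi3 : IntegrableOn (fun t => (V + boxCount C N R θ t) * c t) torusSquare := by
    simp_rw [add_mul]
    exact hi0.add hi1
  have hL1 : R ^ 2 * b ≤ ∫ t in torusSquare, |V + boxCount C N R θ t| := by
    have : ∫ t in torusSquare, -((V + boxCount C N R θ t) * c t) ≤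
        ∫ t in torusSquare, |V + boxCount C N R θ t| := by
      refine integral_mono hi3.neg hi2 fun t => ?_
      refine (neg_le_abs _).trans ?_
      rw [abs_mul]
      exact mul_le_of_le_one_right (abs_nonneg _) (Real.abs_cos_le_one _)
    rw [integral_neg] at this
    linarith
  -- Jensen's inequality on the torus, a probability space, passes from exponent `1` to `p`.
  refine (Real.rpow_le_rpow (by positivity) hL1 hp0).trans ?_
  exact (convexOn_rpow hp).map_integral_le (Real.continuous_rpow_const hp0).continuousOn isClosed_Ici
    (.of_forall fun t => mem_Ici.2 (abs_nonneg _)) hi2 (integrable_rpow_boxCount hcl hp0)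

end Norms

/-! ### Averaging over an interval of rotations -/

theorem sqrt_mul_self_mul_sqrt {B R : ℝ} (hB : 0 ≤ B) (hR : 0 < R) :
    √B * B * √R = R ^ 2 * (√(B / R) * (B / R)) := by
  obtain ⟨s, hs, rfl⟩ : ∃ s, 0 < s ∧ R = s ^ 2 :=
    ⟨√R, Real.sqrt_pos.2 hR, (Real.sq_sqrt hR.le).symm⟩
  rw [Real.sqrt_div hB, Real.sqrt_sq hs.le]
  field_simp

theorem mainTheorem8 (γ : ℝ) (hγ : 2 < γ) (C : Set Plane) (hC : IsFlatBody γ C)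
    (p : ℝ) (hp : 1 ≤ p) :
    ∃ c : ℝ, 0 < c ∧ ∀ R : ℝ, 1 ≤ R → c * R ^ (1 / 2 : ℝ) ≤ discrepancyLpAverage C p R := by
  obtain ⟨m₁, m₂, hm, h₀, hh₀, hF⟩ := hC.exists_integral_cos_le hγ
  -- One frequency serves all `R ≥ 1`: this `K` brings the half-wavelength below `h₀` already at `R
  -- = 1`, for every slope in `[m₁, m₂]`.
  obtain ⟨K, hK⟩ := exists_nat_ge ((1 + |m₁| + |m₂|) / (2 * h₀))
  have hcl := hC.isCompact.isClosed
  have hpi := Real.pi_pos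
  have hp0 : 0 < p := by linarith
  have hK0 : (0 : ℝ) < K := lt_of_lt_of_le (by positivity) hK
  set b : ℝ := √(1 / (2 * K)) * (1 / (2 * K)) with hb
  have hb0 : 0 < b := by positivity
  set θ₁ := Real.pi / 2 - Real.arctan m₂ with hθ₁
  set θ₂ := Real.pi / 2 - Real.arctan m₁ with hθ₂
  have hθ : θ₁ < θ₂ := by
    have := Real.arctan_strictMono hm
    rw [hθ₁, hθ₂]; linarith
  have hθ₁0 : 0 ≤ θ₁ := by rw [hθ₁]; linarith [Real.arctan_lt_pi_div_two m₂]
  have hθ₂π : θ₂ ≤ 2 * Real.pi := by rw [hθ₂]; linarith [Real.neg_pi_div_two_lt_arctan m₁]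
  set w := (2 * Real.pi)⁻¹ * (θ₂ - θ₁) with hw
  have hw0 : 0 < w := mul_pos (by positivity) (by linarith)
  refine ⟨w ^ (1 / p) * b, by positivity, fun R hR => ?_⟩
  have hR0 : 0 < R := by linarith
  obtain ⟨N, hN⟩ := exists_nat_ge (R + 1)
  set V := -R ^ 2 * volume.real C with hV
  set g : ℝ → ℝ := fun θ => ∫ t in torusSquare, |V + boxCount C N R θ t| ^ p with hg
  have hint : ∀ θ, ∫ t in torusSquare, |discrepancy (rot θ '' C) R t| ^ p = g θ := fun θ =>
    setIntegral_congr_fun measurableSet_torusSquare fun t ht => by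
      simp only [discrepancy_eq_boxCount hC.subset_square hR0 hN ht, hV]
  have hlow : ∀ θ ∈ Icc θ₁ θ₂, (b * √R) ^ p ≤ g θ := by
    intro θ hθm
    -- With `m` the cotangent of `θ`, the first coordinate of `rot θ v` is `-sin θ * (v 1 - m * v
    -- 0)`: rotating the body selects the slope.
    set m := Real.tan (Real.pi / 2 - θ) with hmdef
    have harc : Real.arctan m = Real.pi / 2 - θ := by
      apply Real.arctan_tan
      · linarith [hθm.2, Real.neg_pi_div_two_lt_arctan m₁]
      · linarith [hθm.1, Real.arctan_lt_pi_div_two m₂]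
    have hmI : m ∈ Icc m₁ m₂ := by
      constructor
      · rw [← Real.arctan_strictMono.le_iff_le, harc]; linarith [hθm.2]
      · rw [← Real.arctan_strictMono.le_iff_le, harc]; linarith [hθm.1]
    have hsq0 : 0 < √(1 + m ^ 2) := Real.sqrt_pos.2 (by positivity)
    have hsin : Real.sin θ = 1 / √(1 + m ^ 2) := by
      rw [← Real.cos_arctan, harc, Real.cos_pi_div_two_sub]
    have hsin0 : 0 < Real.sin θ := by rw [hsin]; positivity
    have hcos : Real.cos θ = m * Real.sin θ := by
      rw [hsin, ← Real.sin_pi_div_two_sub, ← harc, Real.sin_arctan]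
      ring
    set h := 1 / (2 * K * R * Real.sin θ) with hh
    have hh0 : 0 < h := by positivity
    have hhle : h ≤ h₀ := by
      have h1 : √(1 + m ^ 2) ≤ 1 + |m₁| + |m₂| := by
        rw [Real.sqrt_le_left (by positivity)]
        have h2 : |m| ≤ |m₁| + |m₂| := abs_le.2
          ⟨by linarith [hmI.1, neg_abs_le m₁, abs_nonneg m₂],
            by linarith [hmI.2, le_abs_self m₂, abs_nonneg m₁]⟩
        rw [← sq_abs m]
        nlinarith [abs_nonneg m]
      have h3 : 1 + |m₁| + |m₂| ≤ K * (2 * h₀) := by rwa [div_le_iff₀ (by positivity)] at hK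
      have h4 : h = √(1 + m ^ 2) / (2 * K * R) := by
        rw [hh, hsin]; field_simp
      rw [h4, div_le_iff₀ (by positivity)]
      have : K * (2 * h₀) * 1 ≤ K * (2 * h₀) * R :=
        mul_le_mul_of_nonneg_left hR (by positivity)
      linarith
    have hhge : 1 / (2 * K) / R ≤ h := by
      rw [hh, div_div]
      apply one_div_le_one_div_of_le (by positivity)
      exact mul_le_of_le_one_right (by positivity) (Real.sin_le_one θ)
    obtain ⟨y₀, hy₀⟩ := hF m hmI
    have hF' := hy₀ h hh0 hhle
    -- The phase of the Fourier coefficient is free, so it is chosen to anchor the cosine at the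
    -- lower support level `y₀`.
    have hcoef : ∫ v in C, Real.cos (2 * Real.pi * (K : ℤ) * R * rot θ v 0 - -(Real.pi / h * y₀)) ≤
        -(√h * h) := by
      refine le_of_eq_of_le (integral_congr_ae (.of_forall fun v => ?_)) hF'
      have e : Real.pi / h = 2 * Real.pi * K * R * Real.sin θ := by rw [hh]; field_simp
      simp only [rot, hcos, e, Int.cast_natCast]
      rw [← Real.cos_neg]
      congr 1
      simp
      ring
    refine le_trans ?_ (rpow_le_integral_boxCount hC.isCompact hC.subset_square hR0 hN hp
      (K := (K : ℤ)) (by exact_mod_cast hK0.ne') _ (by positivity) hcoef)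
    apply Real.rpow_le_rpow (by positivity) _ hp0.le
    calc b * √R = R ^ 2 * (√(1 / (2 * K) / R) * (1 / (2 * K) / R)) := by
          rw [hb, sqrt_mul_self_mul_sqrt (by positivity) hR0]
      _ ≤ R ^ 2 * (√h * h) := by
          apply mul_le_mul_of_nonneg_left _ (sq_nonneg R)
          exact mul_le_mul (Real.sqrt_le_sqrt hhge) hhge (by positivity) (Real.sqrt_nonneg _)
  have hgi : ∀ a b, IntervalIntegrable g volume a b := fun a b =>
    intervalIntegrable_integral_rpow_boxCount hcl hp0.le a b
  -- The other angles contribute a nonnegative amount and are discarded.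
  have htot : (θ₂ - θ₁) * (b * √R) ^ p ≤ ∫ θ in (0 : ℝ)..(2 * Real.pi), g θ := by
    refine le_trans ?_ (intervalIntegral.integral_mono_interval hθ₁0 hθ.le hθ₂π
      (.of_forall fun θ => integral_nonneg fun t => Real.rpow_nonneg (abs_nonneg _) _) (hgi _ _))
    have := intervalIntegral.integral_mono_on hθ.le
      (intervalIntegrable_const (c := (b * √R) ^ p)) (hgi θ₁ θ₂) hlow
    simpa using this
  unfold discrepancyLpAverage
  simp_rw [hint]
  rw [← Real.sqrt_eq_rpow]
  have e : w ^ (1 / p) * b * √R = (w * (b * √R) ^ p) ^ (1 / p) := by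
    rw [Real.mul_rpow hw0.le (by positivity), one_div, Real.rpow_rpow_inv (by positivity) hp0.ne']
    ring
  rw [e]
  apply Real.rpow_le_rpow (by positivity) _ (by positivity)
  rw [hw, mul_assoc]
  exact mul_le_mul_of_nonneg_left htot (by positivity)
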